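/- \textbf{Setting.} Let $N,k,l\ge 1$, $r=k+l$, and let $R$ be a commutative ring. For $d\ge 1$ order the monomials in $d$ variables degree-lexicographically (first by total degree, then lexicographically, so that e.g. $x^2,xy,y^2$ come in this order). Let $e_1,\dots,e_\ell$ be the ordered list of all monomials in $r$ variables of total degree $\le N$. For $\underline z_1,\dots,\underline z_\ell\in R^r$ let $V^{\mathrm{hom}}_{N,r}(\underline z_1,\dots,\underline z_\ell)=(e_j(\underline z_i))_{i,j}$, and write $\underline z_i=(z_i',z_i'')$ with $z_i'\in R^k$, $z_i''\in R^l$. Put $m=(N+1)^k$ and $n=(N+1)^l$, let $f_1,\dots,f_m$ and $g_1,\dots,g_n$ be the ordered lists of monomials of degree $\le N$ in each variable, in the first $k$ and in the last $l$ variables respectively, and let $w_1,\dots,w_{mn}$ be any enumeration of the monomials in $r$ variables of degree $\le N$ in each variable such that $w_s=e_s$ for $s\le \ell$. Write $w_s=f_{p(s)}g_{q(s)}$, and let $\varepsilon(w)$ be the sign of the permutation $s\mapsto p(s)+m(q(s)-1)$ of $\{1,\dots,mn\}$. \textbf{Degenerate Vandermonde determinants.} For a sequence $c=(c_1,\dots,c_m)$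 of distinct elements of $\{1,\dots,mn\}$ define $D'(c)\in R$ as follows. Let $T=\{t: c_t>\ell\}$. If the numbers $p(c_t)$, $t\in T$, are not distinct, then $D'(c)=0$. Otherwise let $\pi$ be the permutation of $\{1,\dots,m\}$ with $\pi(t)=p(c_t)$ for $t\in T$ which is increasing on the complement $T^c$, and put $$D'(c)=\varepsilon(\pi)\,\det\bigl(f_{\pi(t')}(z'_{c_t})\bigr)_{t,t'\in T^c},$$ where $\varepsilon$ denotes the sign: up to sign this is the determinant of the Vandermonde matrix in the first $k$ variables at the points $z'_{c_t}$ with $c_t\le \ell$, with the columns of the monomials $f_{p(c_t)}$, $c_t>\ell$, deleted. For a sequence $c$ of length $n$ define $D''(c)$ in the same way, from $q$, $g_1,\dots,g_n$ and the points $z''_s$. \textbf{Tableaux.} A tableau of shape $n^m$ is a filling of an array with $m$ rows and $n$ columns by the numbers $1,\dots,mn$, each used once; it is standard if its rows (left to right) and columns (top to bottom) increase. Let $1_{n^m}$ be the tableau with entry $i+m(j-1)$ in row $i$ and column $j$, and let $\varepsilon(\gamma)$ be the sign of the permutation of $\{1,\dots,mn\}$ that takes $1_{n^m}$ to $\gamma$.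 For standard tableaux $\alpha,\beta$ of shape $n^m$ let $\langle\alpha,\beta'\rangle=0$ if two distinct numbers lie in a common column of $\alpha$ and in a common row of $\beta$; otherwise let $\langle\alpha,\beta'\rangle=\varepsilon(\gamma)$, where $\gamma$ is the unique tableau which agrees with $\alpha$ up to permuting the entries within each column and with $\beta$ up to permuting the entries within each row. Let $G$ be the square integer matrix with entries $\varepsilon(\alpha)\langle\alpha,\beta'\rangle\varepsilon(\beta)$, indexed by pairs of standard tableaux. Let $\mathrm{col}_j(\gamma)$ and $\mathrm{row}_i(\gamma)$ be the sequences of entries of the $j$-th column, from top to bottom, and of the $i$-th row, from left to right. \textbf{Theorem.} The matrix $G$ is invertible over $\mathbb Z$. Let $\Phi=(G^{-1})^{T}$ be its inverse transpose. Then the determinant of the homogeneous Vandermonde matrix is the following sum of products of degenerate Vandermonde determinants in $k$ and in $l$ variables, in which the first $k$ and the last $l$ variables separate: $$\det V^{\mathrm{hom}}_{N,r}(\underline z_1,\dots,\underline z_\ell)=\varepsilon(w)\sum_{\alpha,\beta}\Phi_{\alpha,\beta}\prod_{j=1}^{n}D'(\mathrm{col}_j(\alpha))\prod_{i=1}^{m}D''(\mathrm{row}_i(\beta)),$$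 where $\alpha,\beta$ run over all standard tableaux of shape $n^m$. Moreover, with $H_{m,n}=\prod_{i=0}^{n-1}\frac{(m+i)!}{i!}$, $$H_{m,n}\,\det V^{\mathrm{hom}}_{N,r}(\underline z_1,\dots,\underline z_\ell)=\varepsilon(w)\sum_{\sigma\in\Sigma_{mn}}\varepsilon(\sigma)\prod_{j=1}^{n}D'(\mathrm{col}_j({}^{\sigma}1_{n^m}))\prod_{i=1}^{m}D''(\mathrm{row}_i({}^{\sigma}1_{n^m})),$$ where ${}^{\sigma}1_{n^m}$ is obtained from $1_{n^m}$ by applying $\sigma$ to its entries. -/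

import Mathlib

noncomputable section

namespace HomVandermonde

/-! ### Monomials in degree-lexicographic order -/

/-- Exponent vectors of monomials in `d` variables. -/
def Expo (d : ℕ) : Type := Fin d → ℕ

namespace Expo

variable {d : ℕ}

/-- The total degree. -/
def deg (e : Expo d) : ℕ := ∑ i, e i

/-- Sorting key: total degree first; within a degree, lexicographically in the variables, so that
for instance `x ^ 2`, `x * y`, `y ^ 2` come in this order (hence the order dual). -/
def key (e : Expo d) : ℕ ×ₗ Lex (Fin d → ℕᵒᵈ) :=
  toLex (e.deg, toLex fun i => OrderDual.toDual (e i))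

theorem key_injective : Function.Injective (key : Expo d → _) := by
  intro e f h
  have h2 : (fun i => OrderDual.toDual (e i)) = fun i => OrderDual.toDual (f i) :=
    congrArg (fun x : ℕ ×ₗ Lex (Fin d → ℕᵒᵈ) => ofLex (ofLex x).2) h
  funext i
  exact congrArg OrderDual.ofDual (congrFun h2 i)

/-- The degree-lexicographic order on monomials. -/
instance : LinearOrder (Expo d) := LinearOrder.lift' key key_injective

/-- The value of the monomial with exponent vector `e` at the point `z`. -/
def eval {R : Type*} [CommRing R] (e : Expo d) (z : Fin d → R) : R := ∏ i, z i ^ e i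

end Expo

/-- Monomials in `d` variables of degree at most `N` in each variable. -/
def boxExpo (d N : ℕ) : Finset (Expo d) :=
  Fintype.piFinset fun _ : Fin d => Finset.range (N + 1)

theorem mem_boxExpo {d N : ℕ} {e : Expo d} : e ∈ boxExpo d N ↔ ∀ i, e i ≤ N := by
  refine Fintype.mem_piFinset.trans (forall_congr' fun i => ?_)
  exact Finset.mem_range_succ_iff

theorem card_boxExpo (d N : ℕ) : (boxExpo d N).card = (N + 1) ^ d := by
  refine (Fintype.card_piFinset _).trans ?_
  simp

/-- Monomials in `d` variables of total degree at most `N`. -/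
def homExpo (d N : ℕ) : Finset (Expo d) := (boxExpo d N).filter fun e => e.deg ≤ N

theorem mem_homExpo {d N : ℕ} {e : Expo d} : e ∈ homExpo d N ↔ e.deg ≤ N := by
  refine Finset.mem_filter.trans ⟨fun h => h.2, fun h => ⟨mem_boxExpo.2 fun i => ?_, h⟩⟩
  exact (Finset.single_le_sum (f := e) (fun _ _ => Nat.zero_le _) (Finset.mem_univ i)).trans h

/-- The number of monomials in `d` variables of total degree at most `N`. -/
def homCount (d N : ℕ) : ℕ := (homExpo d N).card

/-- The monomials of total degree at most `N`, listed in degree-lexicographic order. -/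
def homEnum (d N : ℕ) : Fin (homCount d N) ≃o homExpo d N := (homExpo d N).orderIsoOfFin rfl

/-- The monomials of degree at most `N` in each variable, listed in degree-lexicographic order. -/
def boxEnum (d N : ℕ) : Fin ((N + 1) ^ d) ≃o boxExpo d N :=
  (boxExpo d N).orderIsoOfFin (card_boxExpo d N)

/-- The homogeneous Vandermonde matrix: the `i`-th row consists of the values at `z i` of all the
monomials of total degree at most `N`, in degree-lexicographic order. -/
def homVandermonde {R : Type*} [CommRing R] (d N : ℕ) (z : Fin (homCount d N) → Fin d → R) :
    Matrix (Fin (homCount d N)) (Fin (homCount d N)) R :=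
  Matrix.of fun i j => (homEnum d N j).1.eval (z i)

/-! ### Rectangular tableaux and the Fayers matrix -/

/-- Tableaux with `m` rows and `n` columns, not necessarily standard; `T (i, j)` is the entry in
row `i` and column `j`, and the entries are numbered from `0`. -/
abbrev Tableau (m n : ℕ) : Type := Fin m × Fin n ≃ Fin (n * m)

namespace Tableau

variable {m n : ℕ}

/-- Rows increase from left to right and columns from top to bottom. -/
def IsStandard (T : Tableau m n) : Prop :=
  (∀ i, StrictMono fun j => T (i, j)) ∧ ∀ j, StrictMono fun i => T (i, j)

/-- The tableau filled consecutively from top to bottom, then from left to right: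
the entry in row `i` and column `j` is `i + m * j`. -/
def trivial (m n : ℕ) : Tableau m n := (Equiv.prodComm _ _).trans finProdFinEquiv

/-- The sign of the permutation that takes the trivial tableau to `T`. -/
def sign (T : Tableau m n) : ℤˣ := Equiv.Perm.sign ((trivial m n).symm.trans T)

/-- The row of the tableau `T` that contains the entry `s`. -/
def rowOf (T : Tableau m n) (s : Fin (n * m)) : Fin m := (T.symm s).1

/-- The column of the tableau `T` that contains the entry `s`. -/
def colOf (T : Tableau m n) (s : Fin (n * m)) : Fin n := (T.symm s).2

/-- Entry `s` is sent to the cell in the row of `β` and the column of `α` that contain `s`. -/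
def cell (α β : Tableau m n) (s : Fin (n * m)) : Fin m × Fin n := (β.rowOf s, α.colOf s)

theorem cell_bijective {α β : Tableau m n} (h : Function.Injective (cell α β)) :
    Function.Bijective (cell α β) :=
  (Fintype.bijective_iff_injective_and_card _).2 ⟨h, by simp [Nat.mul_comm]⟩

/-- The Fayers number `⟨α, β'⟩`, where `β'` is the conjugate of `β` (so that the columns of `β'`
are the rows of `β`). It is zero if two distinct numbers lie in a common column of `α` and in a
common row of `β`. Otherwise it is the sign of the unique tableau that is column-equivalent
to `α` and row-equivalent to `β`. -/
def fayersNumber (α β : Tableau m n) : ℤ :=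
  open Classical in
  if h : Function.Injective (cell α β) then
    (sign (Equiv.ofBijective (cell α β) (cell_bijective h)).symm : ℤ)
  else 0

end Tableau

/-- Standard tableaux with `m` rows and `n` columns. -/
def StdTableau (m n : ℕ) : Type := {T : Tableau m n // T.IsStandard}

instance (m n : ℕ) : DecidableEq (StdTableau m n) := Classical.decEq _

instance (m n : ℕ) : Fintype (StdTableau m n) :=
  open Classical in inferInstanceAs (Fintype {T : Tableau m n // T.IsStandard})

/-- The Fayers matrix with rows and columns multiplied by the signs of the tableaux. The second
index, a standard tableau of the conjugate shape, is given by its conjugate. -/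
def signedFayersMatrix (m n : ℕ) : Matrix (StdTableau m n) (StdTableau m n) ℤ :=
  Matrix.of fun α β => (α.1.sign : ℤ) * Tableau.fayersNumber α.1 β.1 * (β.1.sign : ℤ)

/-- The inverse transpose of the signed Fayers matrix. -/
def fayersPhi (m n : ℕ) : Matrix (StdTableau m n) (StdTableau m n) ℤ :=
  (signedFayersMatrix m n)⁻¹.transpose

/-- The product of the hook lengths of an `m` by `n` rectangle. -/
def hookProduct (m n : ℕ) : ℕ :=
  ∏ i ∈ Finset.range n, (m + i).factorial / i.factorial

/-! ### Degenerate Vandermonde determinants -/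

/-- The permutation that equals the injective map `g` where `P` holds and maps the remaining
positions to the values not taken by `g` in increasing order. -/
def completion {M : ℕ} {P : Fin M → Prop} (g : {t // P t} → Fin M)
    (hg : Function.Injective g) : Equiv.Perm (Fin M) :=
  open Classical in
  Equiv.subtypeCongr (p := P) (q := fun j => j ∈ Set.range g) (Equiv.ofInjective g hg)
    ((monoEquivOfFin {t // ¬ P t} rfl).symm.toEquiv.trans
      (monoEquivOfFin {j // ¬ j ∈ Set.range g}
        (Fintype.card_compl_eq_card_compl _ _
          (Fintype.card_congr (Equiv.ofInjective g hg))).symm).toEquiv)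

/-- Degenerate Vandermonde determinant: a list `e` of distinct monomials is evaluated at the
same number of points `x`. -/
def degenerateDet {R ι : Type*} [CommRing R] [Fintype ι] [DecidableEq ι] {d : ℕ}
    (x : ι → Fin d → R) (e : ι → Expo d) : R :=
  (Matrix.of fun i j => (e j).eval (x i)).det

/-- The degenerate version of the Vandermonde determinant in `d` variables, of degree at most `N`
in each of them, attached to a list `c` of `(N + 1) ^ d` labels. Labels below `ℓ` stand for the
points `z`, and every other label `s` for the deletion of the monomial `p s`.
If the deleted monomials are distinct, this is, up to an explicit sign, the determinant formed by
those points and the monomials that remain; it is zero otherwise. -/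
def degenerateFactor {R : Type*} [CommRing R] {d N ℓ L : ℕ} (z : Fin ℓ → Fin d → R)
    (p : Fin L → boxExpo d N) (c : Fin ((N + 1) ^ d) → Fin L) : R :=
  open Classical in
  let g : {t // ℓ ≤ (c t).1} → Fin ((N + 1) ^ d) := fun t => (boxEnum d N).symm (p (c t.1))
  if hg : Function.Injective g then
    ((Equiv.Perm.sign (completion g hg) : ℤ) : R) *
      degenerateDet (ι := {t // ¬ ℓ ≤ (c t).1})
        (fun t => z ⟨(c t.1).1, not_le.1 t.2⟩)
        (fun t => (boxEnum d N (completion g hg t.1)).1)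
  else 0

/-! ### Separating the first `k` variables from the last `l` -/

/-- The part of a monomial in the first `k` variables. -/
def leftExpo {k l N : ℕ} (e : boxExpo (k + l) N) : boxExpo k N :=
  ⟨fun i => e.1 (Fin.castAdd l i), mem_boxExpo.2 fun i => mem_boxExpo.1 e.2 (Fin.castAdd l i)⟩

/-- The part of a monomial in the last `l` variables. -/
def rightExpo {k l N : ℕ} (e : boxExpo (k + l) N) : boxExpo l N :=
  ⟨fun i => e.1 (Fin.natAdd k i), mem_boxExpo.2 fun i => mem_boxExpo.1 e.2 (Fin.natAdd k i)⟩

/-- The position of the monomial `e` in the Kronecker product of the lists of monomials in the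
first `k` and in the last `l` variables; if its parts have positions `a` and `b`, this is
`a + (N + 1) ^ k * b`. -/
def kroneckerIndex {k l N : ℕ} (e : boxExpo (k + l) N) : Fin ((N + 1) ^ l * (N + 1) ^ k) :=
  Tableau.trivial _ _ ((boxEnum k N).symm (leftExpo e), (boxEnum l N).symm (rightExpo e))

theorem kroneckerIndex_injective {k l N : ℕ} :
    Function.Injective (kroneckerIndex : boxExpo (k + l) N → _) := by
  intro e f h
  have h1 := (Tableau.trivial _ _).injective h
  have hl : leftExpo e = leftExpo f := (boxEnum k N).symm.injective (congrArg Prod.fst h1)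
  have hr : rightExpo e = rightExpo f := (boxEnum l N).symm.injective (congrArg Prod.snd h1)
  apply Subtype.ext
  funext i
  refine Fin.addCases (fun a => ?_) (fun b => ?_) i
  · exact congrFun (congrArg Subtype.val hl) a
  · exact congrFun (congrArg Subtype.val hr) b

/-- The sign of the passage from an enumeration `w` of the monomials of degree at most `N` in each
variable to the Kronecker product order. -/
def enumerationSign {k l N : ℕ}
    (w : Fin ((N + 1) ^ l * (N + 1) ^ k) ≃ boxExpo (k + l) N) : ℤˣ :=
  Equiv.Perm.sign (Equiv.ofBijective (fun s => kroneckerIndex (w s))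
    (Finite.injective_iff_bijective.1 (kroneckerIndex_injective.comp w.injective)))

section Terms

variable {R : Type*} [CommRing R] {k l N : ℕ}
  (z : Fin (homCount (k + l) N) → Fin (k + l) → R)
  (w : Fin ((N + 1) ^ l * (N + 1) ^ k) ≃ boxExpo (k + l) N)
  (T : Tableau ((N + 1) ^ k) ((N + 1) ^ l))

/-- The product over the columns of `T` of degenerate Vandermonde determinants in the first `k`
variables. -/
def colProduct : R :=
  ∏ j, degenerateFactor (fun s i => z s (Fin.castAdd l i)) (fun s => leftExpo (w s))
    (fun i => T (i, j))

/-- The product over the rows of `T` of degenerate Vandermonde determinants in the last `l`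
variables. -/
def rowProduct : R :=
  ∏ i, degenerateFactor (fun s j => z s (Fin.natAdd k j)) (fun s => rightExpo (w s))
    (fun j => T (i, j))

end Terms

end HomVandermonde

end

namespace HomVandermonde

open Finset

set_option linter.unusedSectionVars false

/-! Write m = (N+1)^k and n = (N+1)^l. Attach to every label `s` a vector of length m and one of
length n: the values of all monomials at the point `s` if `s` stands for a point, and otherwise the
unit vectors at the two parts of `w s`. Then D' and D'' become full determinants of such vectors
(`degenerateFactor_eq_det`), and the homogeneous Vandermonde determinant is, up to
`enumerationSign`, the determinant whose rows are the tensor products of the two vectors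
(`det_homVandermonde_eq`). Both formulas are thus multilinear identities, and it suffices to prove
them for unit vectors, that is, for words `f` and `g` in place of the vectors, with integer values
`wordDet` and `pairDet`.

For the first formula, both sides are, in `f` and in `g` separately, of constant content and
annihilated by all operators that replace one letter by another; in other words, they are invariants
of sl_m and of sl_n. Such a function is determined by its values at lattice words
(`eq_zero_of_isLatticeWord`), which for rectangular content are the row words of standard tableaux
(`exists_standard_filling`). At a row word and a column word of standard tableaux the identity
amounts to G G⁻¹ G = G. The matrix G is invertible because it is triangular, with signs on the
diagonal, for the colexicographic order of row words.

For the second formula, the sum over all fillings alternates under simultaneous permutation of the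
letters of `f` and `g`, so it is a constant multiple of `pairDet` (`alternatingSum_eq`). The
constant is det(∂)^n applied to det^n, and Cayley's identity det(∂) det^(n+1) = (n+1)⋯(n+m) det^n,
applied n times, evaluates it as the hook product (`alternatingSum_trivial`). -/

/-- The determinant of the `0`-`1` matrix whose `i`-th row is the unit vector at `u i`. -/
def wordDet {ι : Type*} [Fintype ι] [DecidableEq ι] (u : ι → ι) : ℤ :=
  (Matrix.of fun i p => if u i = p then (1 : ℤ) else 0).det

/-! ### Determinants of words and of pairs of words -/

section WordDet

variable {ι κ : Type*} [Fintype ι] [DecidableEq ι] [Fintype κ] [DecidableEq κ]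

theorem wordDet_comp_perm (u : ι → ι) (e : Equiv.Perm ι) :
    wordDet (u ∘ e) = (Equiv.Perm.sign e : ℤ) * wordDet u :=
  Matrix.det_permute e (Matrix.of fun i p => if u i = p then (1 : ℤ) else 0)

theorem wordDet_perm (e : Equiv.Perm ι) : wordDet e = (Equiv.Perm.sign e : ℤ) := by
  have h : wordDet (id : ι → ι) = 1 := by
    refine (congrArg Matrix.det ?_).trans (Matrix.det_one (n := ι) (R := ℤ))
    ext i p
    simp [Matrix.one_apply]
  simpa [h] using wordDet_comp_perm id e

theorem wordDet_eq_zero {u : ι → ι} (hu : ¬ Function.Injective u) : wordDet u = 0 := by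
  simp only [Function.Injective, not_forall] at hu
  obtain ⟨a, b, hab, hne⟩ := hu
  exact Matrix.det_zero_of_row_eq hne (by ext p; simp [hab])

theorem wordDet_conj (e : ι ≃ κ) (u : ι → ι) : wordDet (fun k => e (u (e.symm k))) = wordDet u := by
  unfold wordDet
  rw [← Matrix.det_submatrix_equiv_self e]
  congr 1
  ext i j
  simp

theorem wordDet_eq_sum_perm (u : ι → ι) :
    wordDet u = ∑ σ : Equiv.Perm ι, (Equiv.Perm.sign σ : ℤ) * if u = σ then 1 else 0 := by
  unfold wordDet
  rw [← Matrix.det_transpose, Matrix.det_apply']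
  refine sum_congr rfl fun σ _ => ?_
  congr 1
  simp only [Matrix.transpose_apply, Matrix.of_apply]
  rw [Finset.prod_ite_zero]
  simp [funext_iff]

theorem sum_wordDet_mul {R : Type*} [CommRing R] (F : (ι → ι) → R) :
    ∑ u : ι → ι, (wordDet u : R) * F u =
      ∑ σ : Equiv.Perm ι, ((Equiv.Perm.sign σ : ℤ) : R) * F σ := by
  simp_rw [wordDet_eq_sum_perm, Int.cast_sum, sum_mul]
  rw [sum_comm]
  refine sum_congr rfl fun σ _ => ?_
  rw [sum_eq_single (σ : ι → ι)]
  · simp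
  · intro b _ hb
    simp [hb]
  · simp

theorem det_eq_sum_wordDet {R : Type*} [CommRing R] (A : Matrix ι ι R) :
    A.det = ∑ u : ι → ι, (wordDet u : R) * ∏ i, A i (u i) := by
  rw [sum_wordDet_mul, ← Matrix.det_transpose, Matrix.det_apply']
  rfl

/-- The matrix of the combined word is block diagonal, with one block for each `j`. -/
theorem prod_wordDet_snd (f : ι → κ → ι) :
    ∏ j, wordDet (fun i => f i j) = wordDet fun x : ι × κ => (f x.1 x.2, x.2) := by
  unfold wordDet
  rw [← Matrix.det_blockDiagonal]
  congr 1
  ext ⟨i, j⟩ ⟨i', j'⟩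
  simp only [Matrix.blockDiagonal_apply, Matrix.of_apply, Prod.mk.injEq]
  by_cases h : j = j' <;> simp [h]

theorem prod_wordDet_fst (g : ι → κ → κ) :
    ∏ i, wordDet (g i) = wordDet fun x : ι × κ => (x.1, g x.1 x.2) := by
  refine (prod_wordDet_snd fun j i => g i j).trans ?_
  rw [← wordDet_conj (Equiv.prodComm κ ι)]
  rfl

/-- The determinant of the matrix with rows the tensor products of the unit vectors at `f s` and
at `g s`; its columns are numbered by `T`. -/
def pairDet {S : Type*} [Fintype S] [DecidableEq S] (T : ι × κ ≃ S) (f : S → ι) (g : S → κ) : ℤ :=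
  wordDet fun s => T (f s, g s)

variable {S : Type*} [Fintype S] [DecidableEq S] (T : ι × κ ≃ S) (f : S → ι) (g : S → κ)

theorem injective_of_pairDet_ne_zero {T : ι × κ ≃ S} {f : S → ι} {g : S → κ}
    (h : pairDet T f g ≠ 0) : Function.Injective fun s => (f s, g s) := by
  by_contra hc
  exact h (wordDet_eq_zero fun hi => hc (hi.of_comp (f := T)))

theorem card_fiber_of_pairDet_ne_zero {T : ι × κ ≃ S} {f : S → ι} {g : S → κ}
    (h : pairDet T f g ≠ 0) (i : ι) : #{s | f s = i} = Fintype.card κ := by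
  have hb : Function.Bijective fun s => (f s, g s) :=
    (Fintype.bijective_iff_injective_and_card _).2
      ⟨injective_of_pairDet_ne_zero h, Fintype.card_congr T.symm⟩
  rw [← Finset.card_univ]
  refine card_bij (fun s _ => g s) (by simp) ?_ ?_
  · intro a ha b hb' hab
    simp only [mem_filter, mem_univ, true_and] at ha hb'
    exact hb.1 (by simp [ha, hb', hab])
  · intro q _
    obtain ⟨s, hs⟩ := hb.2 (i, q)
    simp only [Prod.mk.injEq] at hs
    exact ⟨s, by simp [hs.1], hs.2⟩

/-- Replacing one letter `i` by `i'` in all possible ways is a derivation, which annihilates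
determinants when `i ≠ i'`. -/
theorem sum_pairDet_update {i i' : ι} (hi : i ≠ i') :
    ∑ t, (if f t = i then pairDet T (Function.update f t i') g else 0) = 0 := by
  set M : Matrix S S ℤ := Matrix.of fun s p => if T (f s, g s) = p then (1 : ℤ) else 0 with hM
  have hup : ∀ t, pairDet T (Function.update f t i') g = M.adjugate (T (i', g t)) t := by
    intro t
    -- An adjugate entry is the determinant with one row replaced by a unit vector, which is exactly
    -- the effect of changing the letter at `t`.
    rw [Matrix.adjugate_apply]
    unfold pairDet wordDet
    congr 1
    ext s p
    rcases eq_or_ne s t with rfl | hs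
    · simp [Pi.single_apply, eq_comm]
    · simp [hs, hM]
  -- This is an off-diagonal entry of `M.adjugate * M`, a scalar matrix.
  have key : ∀ q, ∑ t, M.adjugate (T (i', q)) t * M t (T (i, q)) = 0 := by
    intro q
    rw [← Matrix.mul_apply, Matrix.adjugate_mul, Matrix.smul_apply, Matrix.one_apply_ne, smul_zero]
    simpa using hi.symm
  calc ∑ t, (if f t = i then pairDet T (Function.update f t i') g else 0)
      = ∑ t, ∑ q, M.adjugate (T (i', q)) t * M t (T (i, q)) := by
        refine sum_congr rfl fun t _ => ?_
        rw [sum_eq_single (g t)]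
        · rw [hup]
          simp [hM]
        · intro q _ hq
          simp [hM, hq.symm]
        · simp
    _ = 0 := by rw [sum_comm]; exact sum_eq_zero fun q _ => key q

end WordDet

/-! ### Letter replacement as an sl₂ action on functions of words -/

section Words

variable {S ι : Type*} [Fintype S] [DecidableEq S] [Fintype ι] [DecidableEq ι]

/-- The sum of the values of `x` at all words obtained by replacing one letter `i` by `i'`. -/
def replaceSum (i i' : ι) (x : (S → ι) → ℤ) (h : S → ι) : ℤ :=
  ∑ t, if h t = i then x (Function.update h t i') else 0

/-- Raising and lowering operators are adjoint for the standard inner product: changing the letter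
at `t` from `i` to `i'` is undone by changing it back. -/
theorem sum_replaceSum_mul (i i' : ι) (x y : (S → ι) → ℤ) :
    ∑ h, replaceSum i i' x h * y h = ∑ h, x h * replaceSum i' i y h := by
  simp only [replaceSum, sum_mul, mul_sum]
  refine sum_comm.trans (Eq.trans (sum_congr rfl fun t _ => ?_) sum_comm)
  simp only [ite_mul, zero_mul, mul_ite, mul_zero]
  rw [← sum_filter, ← sum_filter]
  refine sum_bij' (fun h _ => Function.update h t i') (fun h _ => Function.update h t i) ?_ ?_ ?_ ?_ ?_
  · simp
  · simp
  · intro h hh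
    simp only [mem_filter, mem_univ, true_and] at hh
    simp [← hh]
  · intro h hh
    simp only [mem_filter, mem_univ, true_and] at hh
    simp [← hh]
  · intro h hh
    simp only [mem_filter, mem_univ, true_and] at hh
    simp [← hh]

/-- The first term collects the cases where the second replacement undoes the first; in the
remaining sum the two positions differ. -/
theorem replaceSum_replaceSum {i i' : ι} (hi : i ≠ i') (x : (S → ι) → ℤ) (h : S → ι) :
    replaceSum i i' (replaceSum i' i x) h = #{t | h t = i} * x h +
      ∑ t, ∑ u, if h t = i ∧ h u = i' then
        x (Function.update (Function.update h t i') u i) else 0 := by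
  unfold replaceSum
  rw [card_filter, Nat.cast_sum, sum_mul, ← sum_add_distrib]
  refine sum_congr rfl fun t _ => ?_
  by_cases ht : h t = i
  · have hx : x h = ∑ u, if u = t then x h else 0 := by simp
    simp only [ht, if_true, Nat.cast_one, one_mul, true_and]
    rw [hx, ← sum_add_distrib]
    refine sum_congr rfl fun u _ => ?_
    rcases eq_or_ne u t with rfl | hu
    · subst ht
      simp [hi]
    · simp [hu]
  · simp [ht]

/-- The commutator relation [E, F] = H of sl₂: the double sums over distinct positions are symmetric
and cancel. -/
theorem replaceSum_comm {i i' : ι} (hi : i ≠ i') (x : (S → ι) → ℤ) (h : S → ι) :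
    replaceSum i i' (replaceSum i' i x) h + #{t | h t = i'} * x h =
      replaceSum i' i (replaceSum i i' x) h + #{t | h t = i} * x h := by
  rw [replaceSum_replaceSum hi, replaceSum_replaceSum hi.symm]
  have : (∑ t, ∑ u, if h t = i ∧ h u = i' then
        x (Function.update (Function.update h t i') u i) else 0) =
      ∑ t, ∑ u, if h t = i' ∧ h u = i then
        x (Function.update (Function.update h t i) u i') else 0 := by
    rw [sum_comm]
    refine sum_congr rfl fun u _ => sum_congr rfl fun t _ => ?_
    by_cases hh : h t = i ∧ h u = i'
    · have htu : t ≠ u := by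
        rintro rfl
        exact hi (hh.1.symm.trans hh.2)
      rw [if_pos hh, if_pos hh.symm, Function.update_comm htu]
    · rw [if_neg hh, if_neg fun hc => hh hc.symm]
  rw [this]
  ring

/-- A vector of weight zero that is annihilated by the raising operator and also lies in its image
vanishes. -/
theorem eq_zero_of_replaceSum {i i' : ι} (hi : i ≠ i') {y z : (S → ι) → ℤ}
    (hc : ∀ f, y f ≠ 0 → #{t | f t = i} = #{t | f t = i'})
    (hy : ∀ f, replaceSum i i' y f = 0) (hz : ∀ f, replaceSum i i' z f = - y f) (f : S → ι) :
    y f = 0 := by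
  have hsq : ∀ v : (S → ι) → ℤ, ∑ h, v h * v h = 0 → ∀ h, v h = 0 := by
    intro v hv h
    exact mul_self_eq_zero.1
      ((sum_eq_zero_iff_of_nonneg fun h _ => mul_self_nonneg (v h)).1 hv h (mem_univ h))
  -- EFy = FEy + Hy, where Ey = 0 and Hy = 0 because `y` has weight zero.
  have hEF : ∀ h, replaceSum i i' (replaceSum i' i y) h = 0 := by
    intro h
    have h1 := replaceSum_comm hi y h
    have h2 : replaceSum i' i (replaceSum i i' y) h = 0 := by
      rw [show replaceSum i i' y = fun _ => 0 from funext hy]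
      simp [replaceSum]
    rw [h2] at h1
    by_cases h0 : y h = 0
    · simpa [h0] using h1
    · rw [hc h h0] at h1
      linarith
  -- The squared norm of Fy is the inner product of EFy with y.
  have hF : ∀ h, replaceSum i' i y h = 0 := by
    apply hsq
    rw [← sum_replaceSum_mul]
    simp [hEF]
  refine hsq y ?_ f
  -- Since y = -Ez, the squared norm of y is minus the inner product of z with Fy = 0.
  have h3 := sum_replaceSum_mul i i' z y
  simp only [hz, hF, mul_zero, sum_const_zero, neg_mul, sum_neg_distrib, neg_eq_zero] at h3
  exact h3

end Words

/-! ### Lattice words and standard tableaux -/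

/-- The number of letters `i` among the first `k` letters of `f`. -/
def prefixCount {L m : ℕ} (f : Fin L → Fin m) (k : ℕ) (i : Fin m) : ℕ :=
  #{s : Fin L | s.1 < k ∧ f s = i}

/-- Lattice words: no prefix contains a letter more often than the preceding one. -/
def IsLatticeWord {L m : ℕ} (f : Fin L → Fin m) : Prop :=
  ∀ k ≤ L, ∀ i i' : Fin m, i.1 + 1 = i'.1 → prefixCount f k i' ≤ prefixCount f k i

theorem prefixCount_length {L m : ℕ} (f : Fin L → Fin m) (i : Fin m) :
    prefixCount f L i = #{s | f s = i} := by
  simp [prefixCount]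

theorem prefixCount_snoc {L m : ℕ} (f : Fin L → Fin m) (c : Fin m) {k : ℕ} (hk : k ≤ L)
    (i : Fin m) : prefixCount (Fin.snoc f c : Fin (L + 1) → Fin m) k i = prefixCount f k i := by
  simp only [prefixCount, card_filter, Fin.sum_univ_castSucc, Fin.snoc_castSucc, Fin.snoc_last]
  simp [hk]

theorem card_fiber_snoc {L m : ℕ} (f : Fin L → Fin m) (c i : Fin m) :
    #{s | (Fin.snoc f c : Fin (L + 1) → Fin m) s = i} =
      #{s | f s = i} + if c = i then 1 else 0 := by
  simp only [card_filter, Fin.sum_univ_castSucc, Fin.snoc_castSucc, Fin.snoc_last]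

theorem replaceSum_snoc {L m : ℕ} (x : (Fin (L + 1) → Fin m) → ℤ) (i i' c : Fin m)
    (h : Fin L → Fin m) :
    replaceSum i i' x (Fin.snoc h c) = replaceSum i i' (fun f => x (Fin.snoc f c)) h +
      if c = i then x (Fin.snoc h i') else 0 := by
  simp only [replaceSum, Fin.sum_univ_castSucc, Fin.snoc_castSucc, Fin.snoc_last,
    Fin.update_snoc_last, Fin.snoc_update]

/-- A highest weight vector is determined by its coefficients at lattice words. -/
theorem eq_zero_of_isLatticeWord {m : ℕ} : ∀ (L : ℕ) (x : (Fin L → Fin m) → ℤ) (μ : Fin m → ℕ),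
    (∀ f, x f ≠ 0 → ∀ i, #{s | f s = i} = μ i) →
    (∀ i i' : Fin m, i.1 + 1 = i'.1 → ∀ h, replaceSum i i' x h = 0) →
    (∀ f, IsLatticeWord f → x f = 0) → ∀ f, x f = 0 := by
  intro L
  induction L with
  | zero =>
    intro x μ _ _ hl f
    exact hl f fun k _ i i' _ => by simp [prefixCount]
  | succ L IH =>
    intro x μ hμ hE hl
    have key : ∀ c : Fin m, ∀ f, x (Fin.snoc f c) = 0 := by
      intro c
      -- Downward induction on the last letter: the words ending in a larger letter are already
      -- known to give zero, so the slice at `c` is again a highest weight vector.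
      induction c using WellFoundedGT.induction with
      | ind c ih =>
      have hne : ∀ {i i' : Fin m}, i.1 + 1 = i'.1 → i ≠ i' := by
        rintro i i' h rfl
        omega
      have hcnt : ∀ d f, x (Fin.snoc f d) ≠ 0 →
          ∀ i, #{s | f s = i} + (if d = i then 1 else 0) = μ i := by
        intro d f hf i
        rw [← card_fiber_snoc, hμ _ hf]
      have hEc : ∀ i i' : Fin m, i.1 + 1 = i'.1 → ∀ h,
          replaceSum i i' (fun f => x (Fin.snoc f c)) h = 0 := by
        intro i i' hi h
        have h1 := hE i i' hi (Fin.snoc h c)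
        rw [replaceSum_snoc] at h1
        by_cases hci : c = i
        · rw [if_pos hci, ih i' (by rw [hci]; exact Fin.lt_def.2 (by omega)), add_zero] at h1
          exact h1
        · simpa [hci] using h1
      -- In this case appending `c` breaks the lattice condition. The slice at `c` then has weight
      -- zero for the pair `i`, `c`, and it is minus the image of the slice at `i` under raising, so
      -- it vanishes.
      by_cases hbad : ∃ i : Fin m, i.1 + 1 = c.1 ∧ μ c = μ i + 1
      · obtain ⟨i, hi, hμi⟩ := hbad
        refine eq_zero_of_replaceSum (hne hi) (z := fun f => x (Fin.snoc f i)) ?_ (hEc i c hi) ?_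
        · intro f hf
          have h1 := hcnt c f hf c
          have h2 := hcnt c f hf i
          rw [if_pos rfl] at h1
          rw [if_neg (hne hi).symm] at h2
          omega
        · intro f
          have h1 := hE i c hi (Fin.snoc f i)
          rw [replaceSum_snoc, if_pos rfl] at h1
          linarith
      -- Otherwise, if the slice at `c` is nonzero at a lattice word, appending `c` gives a lattice
      -- word again, so the induction on the length applies.
      · refine IH _ (fun i => μ i - if c = i then 1 else 0) ?_ hEc ?_
        · intro f hf i
          have := hcnt c f hf i
          omega
        · intro f hf
          by_contra hx
          refine hx (hl _ fun k hk i i' hi => ?_)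
          rcases Nat.lt_or_ge L k with hk' | hk'
          · obtain rfl : k = L + 1 := by omega
            rw [prefixCount_length, prefixCount_length, hμ _ hx, hμ _ hx]
            have h1 := hcnt c f hx i
            have h2 := hcnt c f hx i'
            have h3 := hf L le_rfl i i' hi
            rw [prefixCount_length, prefixCount_length] at h3
            by_cases hci : c = i'
            · subst hci
              have h4 : μ c ≠ μ i + 1 := fun h => hbad ⟨i, hi, h⟩
              rw [if_pos rfl] at h2
              split_ifs at h1 <;> omega
            · rw [if_neg hci] at h2
              split_ifs at h1 <;> omega
          · rw [prefixCount_snoc _ _ hk', prefixCount_snoc _ _ hk']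
            exact hf k hk' i i' hi
    intro f
    rw [← Fin.snoc_init_self f]
    exact key _ _

/-- The lattice words in which every letter occurs `n` times are the row words of the standard
tableaux. -/
theorem exists_standard_filling {L m n : ℕ} (f : Fin L → Fin m) (hf : IsLatticeWord f)
    (hc : ∀ i, #{s | f s = i} = n) :
    ∃ T : Fin m × Fin n ≃ Fin L, (∀ i, StrictMono fun j => T (i, j)) ∧
      (∀ j, StrictMono fun i => T (i, j)) ∧ ∀ s, (T.symm s).1 = f s := by
  let pos : (i : Fin m) → Fin n ↪o Fin L := fun i => orderEmbOfFin _ (hc i)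
  have hpos : ∀ i j, f (pos i j) = i := fun i j =>
    (mem_filter.1 (orderEmbOfFin_mem _ (hc i) j)).2
  have hsurj : ∀ s, ∃ j, pos (f s) j = s := fun s => by
    have : s ∈ Set.range (pos (f s)) := by
      rw [range_orderEmbOfFin]
      simp
    exact this
  have hbij : Function.Bijective fun x : Fin m × Fin n => pos x.1 x.2 := by
    constructor
    · rintro ⟨i, j⟩ ⟨i', j'⟩ h
      have hi : i = i' := by rw [← hpos i j, ← hpos i' j']; exact congrArg f h
      subst hi
      exact Prod.ext rfl ((pos i).injective h)
    · intro s
      obtain ⟨j, hj⟩ := hsurj s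
      exact ⟨(f s, j), hj⟩
  -- If the `j`-th `i'` preceded the `j`-th `i`, the prefix ending there would contain more letters
  -- `i'` than `i`.
  have hstep : ∀ (i i' : Fin m) (_ : i.1 + 1 = i'.1) (j : Fin n), pos i j < pos i' j := by
    intro i i' hi j
    by_contra hlt
    have hne : pos i' j ≠ pos i j := fun h => by
      have h2 : i' = i := by rw [← hpos i' j, ← hpos i j, h]
      rw [h2] at hi
      omega
    have hlt' : pos i' j < pos i j := lt_of_le_of_ne (not_lt.1 hlt) hne
    have h1 : j.1 + 1 ≤ prefixCount f ((pos i' j).1 + 1) i' := by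
      rw [← Fin.card_Iic, ← card_map (pos i').toEmbedding]
      refine card_le_card fun s hs => ?_
      simp only [mem_map, mem_Iic] at hs
      obtain ⟨j', hj', rfl⟩ := hs
      simp only [mem_filter, mem_univ, true_and]
      exact ⟨Nat.lt_succ_of_le ((pos i').monotone hj'), hpos i' j'⟩
    have h2 : prefixCount f ((pos i' j).1 + 1) i ≤ j.1 := by
      refine le_of_le_of_eq ?_ (Fin.card_Iio j)
      rw [← card_map (pos i).toEmbedding]
      refine card_le_card fun s hs => ?_
      simp only [mem_filter, mem_univ, true_and] at hs
      obtain ⟨j', hj'⟩ := hsurj s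
      rw [hs.2] at hj'
      simp only [mem_map, mem_Iio]
      refine ⟨j', (pos i).lt_iff_lt.1 ?_, hj'⟩
      rw [hj']
      exact lt_of_le_of_lt (Fin.le_def.2 (Nat.le_of_lt_succ hs.1)) hlt'
    have := hf ((pos i' j).1 + 1) (pos i' j).2 i i' hi
    omega
  refine ⟨Equiv.ofBijective _ hbij, fun i => (pos i).strictMono, fun j => ?_, fun s => ?_⟩
  · cases m with
    | zero => exact fun i => i.elim0
    | succ m => exact Fin.strictMono_iff_lt_succ.2 fun i => hstep _ _ (by simp) j
  · obtain ⟨x, rfl⟩ := (Equiv.ofBijective _ hbij).surjective s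
    rw [Equiv.symm_apply_apply]
    exact (hpos x.1 x.2).symm

/-! ### Fayers numbers and triangularity -/

namespace Tableau

variable {m n : ℕ}

@[simp] theorem rowOf_apply (T : Tableau m n) (x : Fin m × Fin n) : T.rowOf (T x) = x.1 := by
  simp [rowOf]

@[simp] theorem colOf_apply (T : Tableau m n) (x : Fin m × Fin n) : T.colOf (T x) = x.2 := by
  simp [colOf]

theorem apply_rowOf_colOf (T : Tableau m n) (s : Fin (n * m)) : T (T.rowOf s, T.colOf s) = s := by
  simp [rowOf, colOf]

theorem fayersNumber_eq_pairDet (α β : Tableau m n) :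
    fayersNumber α β = pairDet (trivial m n) β.rowOf α.colOf := by
  unfold fayersNumber
  split_ifs with h
  · have h1 := wordDet_perm
      ((Equiv.ofBijective (cell α β) (cell_bijective h)).trans (trivial m n))
    have h2 : pairDet (trivial m n) β.rowOf α.colOf =
      wordDet ((Equiv.ofBijective (cell α β) (cell_bijective h)).trans (trivial m n)) := rfl
    rw [h2, h1, ← Equiv.Perm.sign_symm]
    rfl
  · by_contra hc
    exact h (injective_of_pairDet_ne_zero (Ne.symm hc))

/-- The product of blocks is one determinant of a word on the cells; moving from the cells to the
entries of `T` costs its sign. -/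
theorem prod_column_wordDet (T : Tableau m n) (f : Fin (n * m) → Fin m) :
    ∏ j, wordDet (fun i => f (T (i, j))) = (T.sign : ℤ) * pairDet (trivial m n) f T.colOf := by
  rw [prod_wordDet_snd fun i j => f (T (i, j)), ← wordDet_conj (trivial m n), sign, pairDet,
    ← wordDet_comp_perm]
  congr 1
  funext s
  simp [colOf]

theorem prod_row_wordDet (T : Tableau m n) (g : Fin (n * m) → Fin n) :
    ∏ i, wordDet (fun j => g (T (i, j))) = (T.sign : ℤ) * pairDet (trivial m n) T.rowOf g := by
  rw [prod_wordDet_fst fun i j => g (T (i, j)), ← wordDet_conj (trivial m n), sign, pairDet,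
    ← wordDet_comp_perm]
  congr 1
  funext s
  simp [rowOf]

theorem rowOf_injOn {α β : Tableau m n} (hα : α.IsStandard) (hβ : β.IsStandard)
    (h : α.rowOf = β.rowOf) : α = β := by
  have hr : ∀ T : Tableau m n, ∀ i, Set.range (fun j => T (i, j)) = {s | T.rowOf s = i} := by
    intro T i
    ext s
    constructor
    · rintro ⟨j, rfl⟩
      simp
    · rintro rfl
      exact ⟨T.colOf s, T.apply_rowOf_colOf s⟩
  refine Equiv.ext fun x => ?_
  exact congrFun (((hα.1 x.1).range_inj (hβ.1 x.1)).1 (by rw [hr, hr, h])) x.2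

/-- A standard tableau dominates every tableau with which it has a nonzero Fayers number. -/
theorem toColex_rowOf_le {α β : Tableau m n} (hα : α.IsStandard) (h : fayersNumber α β ≠ 0) :
    toColex β.rowOf ≤ toColex α.rowOf := by
  rw [fayersNumber_eq_pairDet] at h
  refine not_lt.1 fun hlt => ?_
  obtain ⟨s, hs, hlt⟩ : ∃ s, (∀ t, s < t → α.rowOf t = β.rowOf t) ∧ α.rowOf s < β.rowOf s := hlt
  -- Here `s` is the last entry whose rows differ. The entry of `α` in the column of `s` and in row
  -- `β.rowOf s` is larger, so its row is the same in both tableaux; it then shares a column of `α`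
  -- and a row of `β` with `s`.
  have h1 : s < α (β.rowOf s, α.colOf s) := by
    conv_lhs => rw [← α.apply_rowOf_colOf s]
    exact hα.2 _ hlt
  have h2 := hs _ h1
  rw [rowOf_apply] at h2
  exact h1.ne' (injective_of_pairDet_ne_zero h (by simp [← h2]))

end Tableau

open Tableau

theorem isUnit_det_signedFayersMatrix (m n : ℕ) : IsUnit (signedFayersMatrix m n).det := by
  let _ : LinearOrder (StdTableau m n) := LinearOrder.lift' (fun α => toColex α.1.rowOf)
    fun α β h => Subtype.ext (rowOf_injOn α.2 β.2 (toColex.injective h))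
  have hlow : (signedFayersMatrix m n).IsLowerTriangular := by
    intro α β hlt
    by_contra hne
    refine not_le.2 (show toColex α.1.rowOf < toColex β.1.rowOf from hlt)
      (toColex_rowOf_le α.2 fun h => hne ?_)
    simp [signedFayersMatrix, h]
  have hdet := Matrix.det_of_isLowerTriangular _ hlow
  have hu : IsUnit (∏ α, signedFayersMatrix m n α α) := by
    rw [IsUnit.prod_univ_iff]
    intro α
    have hinj : Function.Injective (cell α.1 α.1) := α.1.symm.injective
    simp only [signedFayersMatrix, Matrix.of_apply, fayersNumber, hinj, dif_pos]
    exact ((Units.isUnit _).mul (Units.isUnit _)).mul (Units.isUnit _)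
  rw [← hdet] at hu
  convert hu

/-- A function of words that satisfies the relations of a product of minors is determined by its
values at the row words of standard tableaux. -/
theorem eq_zero_of_standard_rows {m n : ℕ} (x : (Fin (n * m) → Fin m) → ℤ)
    (hc : ∀ f, x f ≠ 0 → ∀ i, #{s | f s = i} = n)
    (hE : ∀ i i' : Fin m, i ≠ i' → ∀ h, replaceSum i i' x h = 0)
    (hs : ∀ β : StdTableau m n, x β.1.rowOf = 0) (f : Fin (n * m) → Fin m) : x f = 0 := by
  refine eq_zero_of_isLatticeWord _ x (fun _ => n) hc (fun i i' hi => hE i i' ?_) ?_ f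
  · rintro rfl
    omega
  · intro f hf
    by_contra hx
    obtain ⟨T, hr, hcol, hT⟩ := exists_standard_filling f hf (hc f hx)
    refine hx ?_
    have := hs ⟨T, hr, hcol⟩
    rwa [show Tableau.rowOf T = f from funext hT] at this

theorem eq_zero_of_standard_columns {m n : ℕ} (x : (Fin (n * m) → Fin n) → ℤ)
    (hc : ∀ f, x f ≠ 0 → ∀ i, #{s | f s = i} = m)
    (hE : ∀ i i' : Fin n, i ≠ i' → ∀ h, replaceSum i i' x h = 0)
    (hs : ∀ α : StdTableau m n, x α.1.colOf = 0) (f : Fin (n * m) → Fin n) : x f = 0 := by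
  refine eq_zero_of_isLatticeWord _ x (fun _ => m) hc (fun i i' hi => hE i i' ?_) ?_ f
  · rintro rfl
    omega
  · intro f hf
    by_contra hx
    obtain ⟨T, hr, hcol, hT⟩ := exists_standard_filling f hf (hc f hx)
    refine hx ?_
    have := hs ⟨(Equiv.prodComm _ _).trans T, hcol, hr⟩
    rwa [show Tableau.colOf ((Equiv.prodComm (Fin m) (Fin n)).trans T) = f from funext hT] at this

/-! ### The expansion over standard tableaux for words -/

section Expansion

variable {m n : ℕ}

theorem replaceSum_sub {S ι : Type*} [Fintype S] [DecidableEq S] [DecidableEq ι] (i i' : ι)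
    (x y : (S → ι) → ℤ) (h : S → ι) :
    replaceSum i i' (fun f => x f - y f) h = replaceSum i i' x h - replaceSum i i' y h := by
  simp only [replaceSum, ← sum_sub_distrib]
  exact sum_congr rfl fun t _ => by split_ifs <;> simp

theorem replaceSum_sum {S ι A : Type*} [Fintype S] [DecidableEq S] [DecidableEq ι] [Fintype A]
    (i i' : ι) (x : A → (S → ι) → ℤ) (h : S → ι) :
    replaceSum i i' (fun f => ∑ a, x a f) h = ∑ a, replaceSum i i' (x a) h := by
  simp only [replaceSum]
  rw [sum_comm]
  exact sum_congr rfl fun t _ => by split_ifs <;> simp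

theorem replaceSum_mul_left {S ι : Type*} [Fintype S] [DecidableEq S] [DecidableEq ι] (i i' : ι)
    (x : (S → ι) → ℤ) (c : ℤ) (h : S → ι) :
    replaceSum i i' (fun f => c * x f) h = c * replaceSum i i' x h := by
  simp [replaceSum, mul_sum]

/-- This is G G⁻¹ G = G with the signs of the tableaux stripped off. -/
theorem sum_fayersPhi (γ δ : StdTableau m n) :
    ∑ α, ∑ β, fayersPhi m n α β * (((α.1.sign : ℤ) * fayersNumber α.1 γ.1) *
      ((β.1.sign : ℤ) * fayersNumber δ.1 β.1)) = fayersNumber δ.1 γ.1 := by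
  set G := signedFayersMatrix m n with hG
  have hsq : ∀ T : Tableau m n, (T.sign : ℤ) * (T.sign : ℤ) = 1 := fun T => by
    rw [← Units.val_mul, Int.units_mul_self, Units.val_one]
  have h1 : ∀ α β : StdTableau m n,
      G α β = (α.1.sign : ℤ) * fayersNumber α.1 β.1 * (β.1.sign : ℤ) := fun _ _ => rfl
  have h2 : G * G⁻¹ * G = G := by
    rw [Matrix.mul_nonsing_inv _ (isUnit_det_signedFayersMatrix m n), Matrix.one_mul]
  have h3 : ∑ α, ∑ β, G δ β * G⁻¹ β α * G α γ = G δ γ := by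
    conv_rhs => rw [← h2]
    simp only [Matrix.mul_apply, sum_mul]
  have h4 : fayersNumber δ.1 γ.1 = (δ.1.sign : ℤ) * G δ γ * (γ.1.sign : ℤ) := by
    rw [h1]
    linear_combination (-fayersNumber δ.1 γ.1 * (γ.1.sign : ℤ) * (γ.1.sign : ℤ)) * hsq δ.1 -
      fayersNumber δ.1 γ.1 * hsq γ.1
  rw [h4, ← h3, mul_sum, sum_mul]
  refine sum_congr rfl fun α _ => ?_
  rw [mul_sum, sum_mul]
  refine sum_congr rfl fun β _ => ?_
  rw [show fayersPhi m n α β = G⁻¹ β α from rfl, h1 δ β, h1 α γ]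
  linear_combination (-G⁻¹ β α * (α.1.sign : ℤ) * fayersNumber α.1 γ.1 * (β.1.sign : ℤ) *
    fayersNumber δ.1 β.1) * ((δ.1.sign : ℤ) * (δ.1.sign : ℤ) * hsq γ.1 + hsq δ.1)

theorem pairDet_eq_sum_fayersPhi (f : Fin (n * m) → Fin m) (g : Fin (n * m) → Fin n) :
    pairDet (trivial m n) f g = ∑ α : StdTableau m n, ∑ β : StdTableau m n, fayersPhi m n α β *
      ((∏ j, wordDet fun i => f (α.1 (i, j))) * ∏ i, wordDet fun j => g (β.1 (i, j))) := by
  simp only [prod_column_wordDet, prod_row_wordDet]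
  let K := pairDet (trivial m n)
  -- The difference of the two sides inherits content and annihilation from `pairDet`, and it
  -- remains to see that it vanishes at words of standard tableaux.
  let X : (Fin (n * m) → Fin m) → (Fin (n * m) → Fin n) → ℤ := fun f g =>
    K f g - ∑ α : StdTableau m n, ∑ β : StdTableau m n,
      fayersPhi m n α β * ((α.1.sign * K f α.1.colOf) * (β.1.sign * K β.1.rowOf g))
  have hKr : ∀ i i' : Fin m, i ≠ i' → ∀ g h, replaceSum i i' (fun f => K f g) h = 0 :=
    fun i i' hi g h => sum_pairDet_update _ h g hi
  have hKc : ∀ i i' : Fin n, i ≠ i' → ∀ f h, replaceSum i i' (fun g => K f g) h = 0 :=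
    fun i i' hi f h => sum_pairDet_update ((Equiv.prodComm _ _).trans (trivial m n)) h f hi
  have hr : ∀ i i' : Fin m, i ≠ i' → ∀ g h, replaceSum i i' (fun f => X f g) h = 0 := by
    intro i i' hi g h
    simp only [X]
    rw [replaceSum_sub, hKr i i' hi, replaceSum_sum, zero_sub, neg_eq_zero]
    refine sum_eq_zero fun α _ => ?_
    rw [replaceSum_sum]
    refine sum_eq_zero fun β _ => ?_
    have : (fun f => fayersPhi m n α β *
        ((α.1.sign * K f α.1.colOf) * (β.1.sign * K β.1.rowOf g))) = fun f =>
        (fayersPhi m n α β * α.1.sign * (β.1.sign * K β.1.rowOf g)) * K f α.1.colOf := by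
      funext f
      ring
    rw [this, replaceSum_mul_left, hKr i i' hi, mul_zero]
  have hcol : ∀ i i' : Fin n, i ≠ i' → ∀ f h, replaceSum i i' (fun g => X f g) h = 0 := by
    intro i i' hi f h
    simp only [X]
    rw [replaceSum_sub, hKc i i' hi, replaceSum_sum, zero_sub, neg_eq_zero]
    refine sum_eq_zero fun α _ => ?_
    rw [replaceSum_sum]
    refine sum_eq_zero fun β _ => ?_
    have : (fun g => fayersPhi m n α β *
        ((α.1.sign * K f α.1.colOf) * (β.1.sign * K β.1.rowOf g))) = fun g =>
        (fayersPhi m n α β * β.1.sign * (α.1.sign * K f α.1.colOf)) * K β.1.rowOf g := by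
      funext g
      ring
    rw [this, replaceSum_mul_left, hKc i i' hi, mul_zero]
  have hcr : ∀ g f, X f g ≠ 0 → ∀ i, #{s | f s = i} = n := by
    intro g f hX i
    by_contra hne
    have hK : ∀ g, K f g = 0 := fun g => by
      by_contra h0
      exact hne ((card_fiber_of_pairDet_ne_zero h0 i).trans (Fintype.card_fin n))
    exact hX (by simp [X, hK])
  have hcc : ∀ f g, X f g ≠ 0 → ∀ i, #{s | g s = i} = m := by
    intro f g hX i
    by_contra hne
    have hK : ∀ f, K f g = 0 := fun f => by
      by_contra h0
      exact hne ((card_fiber_of_pairDet_ne_zero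
        (T := (Equiv.prodComm _ _).trans (trivial m n)) h0 i).trans (Fintype.card_fin m))
    exact hX (by simp [X, hK])
  have hstd : ∀ γ δ : StdTableau m n, X γ.1.rowOf δ.1.colOf = 0 := by
    intro γ δ
    have h := sum_fayersPhi γ δ
    simp only [fayersNumber_eq_pairDet] at h
    simp only [X, K, h, sub_self]
  -- The words are freed one at a time: `g` here, with `f` still a standard row word, and `f`
  -- afterwards.
  have h1 : ∀ (γ : StdTableau m n) g, X γ.1.rowOf g = 0 := fun γ =>
    eq_zero_of_standard_columns _ (hcc _) (fun i i' hi => hcol i i' hi _) (hstd γ)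
  exact sub_eq_zero.1 (eq_zero_of_standard_rows (fun f => X f g) (hcr g)
    (fun i i' hi => hr i i' hi g) (fun γ => h1 γ g) f)

end Expansion

/-! ### Multilinear expansion from words to arbitrary vectors -/

section RingExpansion

variable {R : Type*} [CommRing R] {ι κ S : Type*} [Fintype ι] [DecidableEq ι] [Fintype κ]
  [DecidableEq κ] [Fintype S] [DecidableEq S]

theorem prod_det_eq_sum_wordDet (a : κ → ι → ι → R) :
    ∏ j, (Matrix.of (a j)).det =
      ∑ U : κ → ι → ι, ((∏ j, wordDet (U j) : ℤ) : R) * ∏ j, ∏ i, a j i (U j i) := by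
  simp_rw [det_eq_sum_wordDet]
  rw [prod_univ_sum, Fintype.piFinset_univ]
  refine sum_congr rfl fun U _ => ?_
  rw [prod_mul_distrib]
  push_cast
  rfl

theorem prod_column_det (T : ι × κ ≃ S) (a : S → ι → R) :
    ∏ j, (Matrix.of fun i p => a (T (i, j)) p).det =
      ∑ f : S → ι, ((∏ j, wordDet fun i => f (T (i, j)) : ℤ) : R) * ∏ s, a s (f s) := by
  rw [prod_det_eq_sum_wordDet fun j i p => a (T (i, j)) p]
  let e : (κ → ι → ι) ≃ (S → ι) :=
    { toFun := fun U s => U (T.symm s).2 (T.symm s).1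
      invFun := fun f j i => f (T (i, j))
      left_inv := fun U => by simp
      right_inv := fun f => by simp }
  refine Fintype.sum_equiv e _ _ fun U => ?_
  congr 1
  · simp [e]
  · rw [← T.prod_comp, Fintype.prod_prod_type_right]
    simp [e]

theorem prod_row_det (T : ι × κ ≃ S) (b : S → κ → R) :
    ∏ i, (Matrix.of fun j q => b (T (i, j)) q).det =
      ∑ g : S → κ, ((∏ i, wordDet fun j => g (T (i, j)) : ℤ) : R) * ∏ s, b s (g s) :=
  prod_column_det ((Equiv.prodComm κ ι).trans T) b

/-- The letters in `S` of the expanding words split into pairs of letters through `T`. -/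
theorem tensor_det (T : ι × κ ≃ S) (a : S → ι → R) (b : S → κ → R) :
    (Matrix.of fun s t => a s (T.symm t).1 * b s (T.symm t).2).det =
      ∑ f : S → ι, ∑ g : S → κ,
        (pairDet T f g : R) * ((∏ s, a s (f s)) * ∏ s, b s (g s)) := by
  rw [det_eq_sum_wordDet, ← Fintype.sum_prod_type']
  let e : (S → S) ≃ (S → ι) × (S → κ) :=
    (Equiv.arrowCongr (Equiv.refl S) T.symm).trans (Equiv.arrowProdEquivProdArrow S _ _)
  refine Fintype.sum_equiv e _ _ fun w => ?_
  rw [← prod_mul_distrib]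
  congr 1
  rw [pairDet]
  congr 2
  funext s
  simp [e, Equiv.arrowProdEquivProdArrow]

theorem sum_mul_sum_expansion {A : Type*} [Fintype A] (x : A → ℤ) (F : A → (S → ι) → ℤ)
    (F' : A → (S → κ) → ℤ) (P : (S → ι) → R) (Q : (S → κ) → R) :
    ∑ f, ∑ g, ((∑ c, x c * (F c f * F' c g) : ℤ) : R) * (P f * Q g) =
      ∑ c, (x c : R) * ((∑ f, (F c f : R) * P f) * ∑ g, (F' c g : R) * Q g) := by
  simp_rw [sum_mul_sum, mul_sum, Int.cast_sum, sum_mul]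
  simp_rw [sum_comm (s := (univ : Finset (S → κ))) (t := (univ : Finset A))]
  rw [sum_comm]
  refine sum_congr rfl fun c _ => sum_congr rfl fun f _ => sum_congr rfl fun g _ => ?_
  push_cast
  ring

end RingExpansion

/-! ### The alternating sum over all fillings -/

section Alternating

variable {m n : ℕ}

/-- The alternating sum over all fillings of the products of column and row minors, evaluated at
unit vectors. -/
def alternatingSum (m n : ℕ) (f : Fin (n * m) → Fin m) (g : Fin (n * m) → Fin n) : ℤ :=
  ∑ σ : Equiv.Perm (Fin (n * m)), (Equiv.Perm.sign σ : ℤ) *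
    ((∏ j, wordDet fun i => f ((Tableau.trivial m n).trans σ (i, j))) *
      ∏ i, wordDet fun j => g ((Tableau.trivial m n).trans σ (i, j)))

theorem alternatingSum_comp_perm (f : Fin (n * m) → Fin m) (g : Fin (n * m) → Fin n)
    (π : Equiv.Perm (Fin (n * m))) :
    alternatingSum m n (f ∘ π) (g ∘ π) = (Equiv.Perm.sign π : ℤ) * alternatingSum m n f g := by
  unfold alternatingSum
  rw [mul_sum]
  refine Fintype.sum_equiv (Equiv.mulLeft π) _ _ fun σ => ?_
  have h : (Equiv.Perm.sign π : ℤ) * (Equiv.Perm.sign π : ℤ) = 1 := by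
    rw [← Units.val_mul, Int.units_mul_self, Units.val_one]
  simp only [Equiv.coe_mulLeft, Equiv.Perm.sign_mul, Units.val_mul, ← mul_assoc, h, one_mul]
  rfl

theorem alternatingSum_eq (f : Fin (n * m) → Fin m) (g : Fin (n * m) → Fin n) :
    alternatingSum m n f g =
      alternatingSum m n (Tableau.trivial m n).rowOf (Tableau.trivial m n).colOf *
        pairDet (Tableau.trivial m n) f g := by
  set T := Tableau.trivial m n with hT
  by_cases hinj : Function.Injective fun s => T (f s, g s)
  · let π : Equiv.Perm (Fin (n * m)) :=
      Equiv.ofBijective _ (Finite.injective_iff_bijective.1 hinj)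
    have hf : f = T.rowOf ∘ π := by
      funext s
      exact (T.rowOf_apply (f s, g s)).symm
    have hg : g = T.colOf ∘ π := by
      funext s
      exact (T.colOf_apply (f s, g s)).symm
    have hp : pairDet T f g = (Equiv.Perm.sign π : ℤ) := wordDet_perm π
    rw [hp, mul_comm, ← alternatingSum_comp_perm, ← hf, ← hg]
  · rw [pairDet, wordDet_eq_zero hinj, mul_zero]
    simp only [Function.Injective, not_forall] at hinj
    obtain ⟨s, t, hst, hne⟩ := hinj
    have hst' := T.injective hst
    simp only [Prod.mk.injEq] at hst'
    -- A transposition fixes both words, so the alternating sum equals its own negative.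
    have hf : f ∘ Equiv.swap s t = f := by
      funext u
      rw [Function.comp_apply, Equiv.swap_apply_def]
      split_ifs with h1 h2
      · rw [h1, hst'.1]
      · rw [h2, hst'.1]
      · rfl
    have hg : g ∘ Equiv.swap s t = g := by
      funext u
      rw [Function.comp_apply, Equiv.swap_apply_def]
      split_ifs with h1 h2
      · rw [h1, hst'.2]
      · rw [h2, hst'.2]
      · rfl
    have h := alternatingSum_comp_perm f g (Equiv.swap s t)
    rw [hf, hg, Equiv.Perm.sign_swap hne] at h
    simp only [Units.val_neg, Units.val_one] at h
    linarith

end Alternating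

/-! ### The two separation formulas for tensor determinants -/

section Separation

variable {R : Type*} [CommRing R] {m n : ℕ} (a : Fin (n * m) → Fin m → R)
  (b : Fin (n * m) → Fin n → R)

theorem tensor_det_eq_sum_fayersPhi :
    (Matrix.of fun s t => a s ((Tableau.trivial m n).symm t).1 *
      b s ((Tableau.trivial m n).symm t).2).det =
      ∑ α : StdTableau m n, ∑ β : StdTableau m n, (fayersPhi m n α β : R) *
        ((∏ j, (Matrix.of fun i p => a (α.1 (i, j)) p).det) *
          ∏ i, (Matrix.of fun j q => b (β.1 (i, j)) q).det) := by
  simp_rw [tensor_det, pairDet_eq_sum_fayersPhi, prod_column_det, prod_row_det]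
  simp_rw [← Fintype.sum_prod_type']
  rw [Fintype.sum_prod_type]
  exact sum_mul_sum_expansion (fun c : StdTableau m n × StdTableau m n => fayersPhi m n c.1 c.2)
    (fun c f => ∏ j, wordDet fun i => f (c.1.1 (i, j)))
    (fun c g => ∏ i, wordDet fun j => g (c.2.1 (i, j)))
    (fun f => ∏ s, a s (f s)) fun g => ∏ s, b s (g s)

theorem alternatingSum_mul_tensor_det :
    (alternatingSum m n (Tableau.trivial m n).rowOf (Tableau.trivial m n).colOf : R) *
      (Matrix.of fun s t => a s ((Tableau.trivial m n).symm t).1 *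
        b s ((Tableau.trivial m n).symm t).2).det =
      ∑ σ : Equiv.Perm (Fin (n * m)), ((Equiv.Perm.sign σ : ℤ) : R) *
        ((∏ j, (Matrix.of fun i p => a ((Tableau.trivial m n).trans σ (i, j)) p).det) *
          ∏ i, (Matrix.of fun j q => b ((Tableau.trivial m n).trans σ (i, j)) q).det) := by
  rw [tensor_det, mul_sum]
  simp_rw [mul_sum, ← mul_assoc (alternatingSum _ _ _ _ : R), ← Int.cast_mul,
    ← alternatingSum_eq, alternatingSum, prod_column_det, prod_row_det]
  exact sum_mul_sum_expansion (fun σ : Equiv.Perm (Fin (n * m)) => (Equiv.Perm.sign σ : ℤ))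
    (fun σ f => ∏ j, wordDet fun i => f ((Tableau.trivial m n).trans σ (i, j)))
    (fun σ g => ∏ i, wordDet fun j => g ((Tableau.trivial m n).trans σ (i, j)))
    (fun f => ∏ s, a s (f s)) fun g => ∏ s, b s (g s)

end Separation

/-! ### Counting pairs of a colouring and a permutation that preserves it -/

/-- Writing a permutation of m + 1 points as a transposition of 0 with `p` after a permutation of
the rest contributes a factor N + m: N colours of 0 if `p` is 0, and one for each of the m other
choices of `p`. -/
theorem sum_card_colouring_stabilizer (N : ℕ) : ∀ m : ℕ,
    ∑ φ : Fin m → Fin N, #{θ : Equiv.Perm (Fin m) | φ ∘ θ = φ} = N.ascFactorial m := by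
  intro m
  induction m with
  | zero =>
    rw [Fintype.sum_unique, Nat.ascFactorial_zero, filter_true_of_mem]
    · simp
    · intro θ _
      exact Subsingleton.elim _ _
  | succ m ih =>
    have hcond : ∀ (c : Fin N) (φ : Fin m → Fin N) (p : Fin (m + 1)) (e : Equiv.Perm (Fin m)),
        (Fin.cons c φ : Fin (m + 1) → Fin N) ∘ Equiv.Perm.decomposeFin.symm (p, e) =
          Fin.cons c φ ↔ (Fin.cons c φ : Fin (m + 1) → Fin N) p = c ∧ φ ∘ e = φ := by
      intro c φ p e
      have hsw : (Fin.cons c φ : Fin (m + 1) → Fin N) p = c → ∀ x,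
          (Fin.cons c φ : Fin (m + 1) → Fin N) (Equiv.swap 0 p x) =
            (Fin.cons c φ : Fin (m + 1) → Fin N) x := by
        intro hp x
        rw [Equiv.swap_apply_def]
        split_ifs with h1 h2
        · rw [hp, h1, Fin.cons_zero]
        · rw [h2, hp, Fin.cons_zero]
        · rfl
      constructor
      · intro h
        have hp : (Fin.cons c φ : Fin (m + 1) → Fin N) p = c := by
          have := congrFun h 0
          simpa [Equiv.Perm.decomposeFin_symm_apply_zero] using this
        refine ⟨hp, funext fun x => ?_⟩
        have := congrFun h x.succ
        rw [Function.comp_apply, Equiv.Perm.decomposeFin_symm_apply_succ, hsw hp] at this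
        simpa using this
      · rintro ⟨hp, he⟩
        funext x
        refine Fin.cases ?_ (fun x => ?_) x
        · rw [Function.comp_apply, Equiv.Perm.decomposeFin_symm_apply_zero, hp, Fin.cons_zero]
        · rw [Function.comp_apply, Equiv.Perm.decomposeFin_symm_apply_succ, hsw hp, Fin.cons_succ,
            Fin.cons_succ]
          exact congrFun he x
    have hcount : ∀ φ : Fin m → Fin N,
        ∑ c : Fin N, ∑ p : Fin (m + 1),
          (if (Fin.cons c φ : Fin (m + 1) → Fin N) p = c then 1 else 0) = N + m := by
      intro φ
      simp_rw [Fin.sum_univ_succ, Fin.cons_zero, Fin.cons_succ, if_true, sum_add_distrib]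
      rw [sum_comm]
      simp
    have hsum : ∑ φ : Fin (m + 1) → Fin N, #{θ : Equiv.Perm (Fin (m + 1)) | φ ∘ θ = φ} =
        ∑ x : Fin N × (Fin m → Fin N), ∑ y : Fin (m + 1) × Equiv.Perm (Fin m),
          if (Fin.cons x.1 x.2 : Fin (m + 1) → Fin N) y.1 = x.1 ∧ x.2 ∘ y.2 = x.2
            then 1 else 0 := by
      refine (Fintype.sum_equiv (Fin.consEquiv fun _ => Fin N) _ _ fun x => ?_).symm
      rw [card_filter]
      refine Fintype.sum_equiv Equiv.Perm.decomposeFin.symm _ _ fun y => ?_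
      exact if_congr (hcond x.1 x.2 y.1 y.2).symm rfl rfl
    rw [hsum, Fintype.sum_prod_type_right, Nat.ascFactorial_succ, ← ih, mul_sum]
    refine sum_congr rfl fun φ _ => ?_
    simp_rw [Fintype.sum_prod_type, ite_and, card_filter]
    rw [← hcount φ, sum_mul]
    refine sum_congr rfl fun c _ => ?_
    rw [sum_mul]
    refine sum_congr rfl fun p _ => ?_
    split_ifs <;> simp

/-! ### Cayley's identity -/

section Cayley

/-- The matrix `X` with the rows `i` such that `φ i = q` replaced by the unit vectors at `u i`. -/
def replaceRows {R : Type*} [CommRing R] {m N : ℕ} (X : Matrix (Fin m) (Fin m) R)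
    (φ : Fin m → Fin N) (q : Fin N) (u : Fin m → Fin m) : Matrix (Fin m) (Fin m) R :=
  Matrix.of fun i p => if φ i = q then (if u i = p then 1 else 0) else X i p

/-- Each factor is `X` multiplied on the left by a matrix with rows of `Y` in the replaced places
and of the identity elsewhere. The remaining blocks of `Y`, one for each colour, form a single
determinant that is block diagonal for `φ`. -/
theorem prod_det_replaceRows {R : Type*} [CommRing R] {m N : ℕ} {X Y : Matrix (Fin m) (Fin m) R}
    (h : Y * X = 1) (φ : Fin m → Fin N) (u : Fin m → Fin m) :
    ∏ q, (replaceRows X φ q u).det =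
      X.det ^ N * (Matrix.of fun i j => if φ i = φ j then Y (u i) j else 0).det := by
  let B : Fin N → Matrix (Fin m) (Fin m) R := fun q =>
    Matrix.of fun i j => if φ i = q then Y (u i) j else (1 : Matrix (Fin m) (Fin m) R) i j
  have hB : ∀ q, (replaceRows X φ q u).det = X.det * (B q).det := by
    intro q
    have h1 : replaceRows X φ q u = B q * X := by
      ext i p
      rw [Matrix.mul_apply]
      by_cases hi : φ i = q
      · simp only [replaceRows, B, Matrix.of_apply, hi, if_true]
        rw [← Matrix.mul_apply, h, Matrix.one_apply]
      · simp only [replaceRows, B, Matrix.of_apply, hi, if_false]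
        rw [← Matrix.mul_apply, Matrix.one_mul]
    rw [h1, Matrix.det_mul, mul_comm]
  simp_rw [hB]
  rw [prod_mul_distrib, prod_const, card_univ, Fintype.card_fin]
  congr 1
  rw [Matrix.BlockTriangular.det_fintype (b := φ)]
  · refine prod_congr rfl fun q _ => ?_
    rw [Matrix.twoBlockTriangular_det (B q) (fun i => φ i = q)]
    · have h2 : (B q).toSquareBlockProp (fun i => ¬ φ i = q) = 1 := by
        ext i j
        simp [B, Matrix.toSquareBlockProp, i.2, Matrix.one_apply, Subtype.ext_iff]
      rw [h2, Matrix.det_one, mul_one]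
      congr 1
      ext i j
      simp [B, Matrix.toSquareBlockProp, Matrix.toSquareBlock, i.2, j.2]
    · intro i hi j hj
      have hij : i ≠ j := by
        rintro rfl
        exact hi hj
      simp [B, hi, hij]
  · intro i j hij
    simp [hij.ne']

/-- For each `θ` that preserves the colours, the sum over `π` is the determinant of `Y` with columns
permuted by `θ`, whose sign cancels the sign of `θ`. -/
theorem sum_sign_det_colouring {R : Type*} [CommRing R] {m N : ℕ} (Y : Matrix (Fin m) (Fin m) R)
    (φ : Fin m → Fin N) :
    ∑ π : Equiv.Perm (Fin m), ((Equiv.Perm.sign π : ℤ) : R) *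
      (Matrix.of fun i j => if φ i = φ j then Y (π i) j else 0).det =
      #{θ : Equiv.Perm (Fin m) | φ ∘ θ = φ} * Y.det := by
  have h1 : ∀ π : Equiv.Perm (Fin m),
      (Matrix.of fun i j => if φ i = φ j then Y (π i) j else 0).det =
      ∑ θ : Equiv.Perm (Fin m), ((Equiv.Perm.sign θ : ℤ) : R) *
        if φ ∘ θ = φ then ∏ i, Y (π i) (θ i) else 0 := by
    intro π
    rw [← Matrix.det_transpose, Matrix.det_apply']
    refine sum_congr rfl fun θ _ => ?_
    simp only [Matrix.transpose_apply, Matrix.of_apply]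
    rw [prod_ite_zero]
    simp [funext_iff, eq_comm]
  simp_rw [h1, mul_sum]
  rw [sum_comm, card_filter, Nat.cast_sum, sum_mul]
  refine sum_congr rfl fun θ _ => ?_
  by_cases hθ : φ ∘ θ = φ
  · simp only [hθ, if_true, Nat.cast_one, one_mul]
    have h2 := Matrix.det_permute' θ Y
    rw [Matrix.det_apply'] at h2
    simp only [Matrix.submatrix_apply, id] at h2
    have h3 : ((Equiv.Perm.sign θ : ℤ) : R) * ((Equiv.Perm.sign θ : ℤ) : R) = 1 := by
      rw [← Int.cast_mul, ← Units.val_mul, Int.units_mul_self, Units.val_one, Int.cast_one]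
    calc _ = ((Equiv.Perm.sign θ : ℤ) : R) *
          ∑ π : Equiv.Perm (Fin m), ((Equiv.Perm.sign π : ℤ) : R) * ∏ i, Y (π i) (θ i) := by
          rw [mul_sum]
          exact sum_congr rfl fun π _ => by ring
      _ = Y.det := by rw [h2, ← mul_assoc, h3, one_mul]
  · simp [hθ]

/-- The left side is det(∂) applied to det^(n+1) by the product rule: `φ i` names the factor hit by
the derivative in row `i`. Taking `Y` to be the inverse matrix reduces it to counting colourings
with stabilizing permutations. -/
theorem cayley_identity_field {K : Type*} [Field K] {m : ℕ} (n : ℕ)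
    {X : Matrix (Fin m) (Fin m) K} (hX : X.det ≠ 0) :
    ∑ φ : Fin m → Fin (n + 1), ∑ u : Fin m → Fin m, (wordDet u : K) *
      ∏ q, (replaceRows X φ q u).det = (n + 1).ascFactorial m * X.det ^ n := by
  have hu : IsUnit X.det := hX.isUnit
  have h : X⁻¹ * X = 1 := Matrix.nonsing_inv_mul _ hu
  simp_rw [prod_det_replaceRows h, sum_wordDet_mul, mul_left_comm _ (X.det ^ (n + 1)), ← mul_sum]
  simp_rw [sum_sign_det_colouring]
  rw [← sum_mul, ← Nat.cast_sum, sum_card_colouring_stabilizer, Matrix.det_nonsing_inv,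
    Ring.inverse_eq_inv']
  field_simp
  ring

/-- Cayley's identity for a power of the generic determinant. -/
theorem cayley_identity (m n : ℕ) :
    ∑ φ : Fin m → Fin (n + 1), ∑ u : Fin m → Fin m, (wordDet u : MvPolynomial (Fin m × Fin m) ℤ) *
      ∏ q, (replaceRows (Matrix.mvPolynomialX (Fin m) (Fin m) ℤ) φ q u).det =
      (n + 1).ascFactorial m * (Matrix.mvPolynomialX (Fin m) (Fin m) ℤ).det ^ n := by
  set A := MvPolynomial (Fin m × Fin m) ℤ
  set X := Matrix.mvPolynomialX (Fin m) (Fin m) ℤ with hXdef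
  let ψ : A →+* FractionRing A := algebraMap A (FractionRing A)
  have hψ : Function.Injective ψ := IsFractionRing.injective A (FractionRing A)
  apply hψ
  have hdet : (ψ.mapMatrix X).det ≠ 0 := by
    rw [← RingHom.map_det]
    exact (map_ne_zero_iff ψ hψ).2 (Matrix.det_mvPolynomialX_ne_zero _ _)
  have hrep : ∀ (φ : Fin m → Fin (n + 1)) q u,
      ψ.mapMatrix (replaceRows X φ q u) = replaceRows (ψ.mapMatrix X) φ q u := by
    intro φ q u
    ext i p
    simp only [replaceRows, RingHom.mapMatrix_apply, Matrix.map_apply, Matrix.of_apply]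
    split_ifs <;> simp
  have := cayley_identity_field n hdet
  simp only [map_sum, map_mul, map_prod, map_pow, map_intCast, map_natCast, RingHom.map_det, hrep]
  exact this

end Cayley

/-! ### Polarized Cayley identity and the hook product -/

section Polarization

variable {m n : ℕ}

/-- The polarization of the `n`-th power of the determinant at the unit vectors given by `f`: in
every row the `n` arguments `f j i` are distributed over the `n` factors in all ways. -/
def polarDet (f : Fin n → Fin m → Fin m) : ℤ :=
  ∑ κ : Fin m → Equiv.Perm (Fin n), ∏ q, wordDet fun i => f (κ i q) i

theorem polarDet_comp_perm (f : Fin n → Fin m → Fin m) (ρ : Fin m → Equiv.Perm (Fin n)) :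
    polarDet (fun j i => f (ρ i j) i) = polarDet f :=
  Fintype.sum_equiv (Equiv.mulLeft ρ) _ _ fun _ => rfl

theorem sum_polarDet_mul {R : Type*} [CommRing R] (Z : Fin n → Fin m → Fin m → R) :
    ∑ f : Fin n → Fin m → Fin m, (polarDet f : R) * ∏ q, ∏ i, Z q i (f q i) =
      ∑ κ : Fin m → Equiv.Perm (Fin n), ∏ q, (Matrix.of fun i p => Z (κ i q) i p).det := by
  simp_rw [polarDet, Int.cast_sum, sum_mul]
  rw [sum_comm]
  refine sum_congr rfl fun κ _ => ?_
  rw [prod_det_eq_sum_wordDet fun q i p => Z (κ i q) i p]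
  let e : (Fin n → Fin m → Fin m) ≃ (Fin n → Fin m → Fin m) :=
    { toFun := fun f q i => f (κ i q) i
      invFun := fun f q i => f ((κ i).symm q) i
      left_inv := fun f => by simp
      right_inv := fun f => by simp }
  refine Fintype.sum_equiv e _ _ fun f => ?_
  congr 1
  rw [prod_comm, prod_comm (t := (univ : Finset (Fin m)))]
  exact prod_congr rfl fun i _ => (Equiv.prod_comp (κ i) fun q => Z q i (f q i)).symm

theorem exists_perm_of_card_fiber_eq {ι α : Type*} [Fintype ι] [DecidableEq α] {v w : ι → α}
    (h : ∀ p, #{j | v j = p} = #{j | w j = p}) : ∃ ρ : Equiv.Perm ι, ∀ j, w (ρ j) = v j := by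
  have h' : ∀ p, Nonempty ({j // v j = p} ≃ {j // w j = p}) := fun p => by
    rw [← Fintype.card_eq, Fintype.card_subtype, Fintype.card_subtype, h]
  exact ⟨Equiv.ofFiberEquiv fun p => (h' p).some, Equiv.ofFiberEquiv_map _⟩

/-- A function that is symmetric in every row is determined by its generating polynomial. -/
theorem eq_zero_of_symmetric (Y : (Fin n → Fin m → Fin m) → ℤ)
    (hY : ∀ f (ρ : Fin m → Equiv.Perm (Fin n)), Y (fun j i => f (ρ i j) i) = Y f)
    (h : ∑ f, (Y f : MvPolynomial (Fin m × Fin m) ℤ) *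
      ∏ j, ∏ i, Matrix.mvPolynomialX (Fin m) (Fin m) ℤ i (f j i) = 0)
    (f : Fin n → Fin m → Fin m) : Y f = 0 := by
  let wt : (Fin n → Fin m → Fin m) → (Fin m × Fin m →₀ ℕ) := fun f =>
    ∑ j, ∑ i, Finsupp.single (i, f j i) 1
  have hwt : ∀ f i p, wt f (i, p) = #{j | f j i = p} := by
    intro f i p
    simp only [wt, Finsupp.finsetSum_apply, Finsupp.single_apply, card_filter]
    refine sum_congr rfl fun j _ => ?_
    rw [sum_eq_single i]
    · simp
    · intro i' _ hi'
      simp [hi']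
    · simp
  have hmon : ∀ f : Fin n → Fin m → Fin m,
      ∏ j, ∏ i, Matrix.mvPolynomialX (Fin m) (Fin m) ℤ i (f j i) =
        MvPolynomial.monomial (wt f) 1 := by
    intro f
    simp only [wt, MvPolynomial.monomial_sum_one, Matrix.mvPolynomialX_apply]
    rfl
  have hcoeff := congrArg (MvPolynomial.coeff (wt f)) h
  have hterm : ∀ g : Fin n → Fin m → Fin m,
      MvPolynomial.coeff (wt f) ((Y g : MvPolynomial (Fin m × Fin m) ℤ) *
        ∏ j, ∏ i, Matrix.mvPolynomialX (Fin m) (Fin m) ℤ i (g j i)) =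
      if wt g = wt f then Y f else 0 := by
    intro g
    rw [hmon, ← zsmul_eq_mul, MvPolynomial.coeff_smul, MvPolynomial.coeff_monomial]
    split_ifs with hg
    · have hex : ∀ i, ∃ ρ : Equiv.Perm (Fin n), ∀ j, f (ρ j) i = g j i := fun i =>
        exists_perm_of_card_fiber_eq fun p =>
          (hwt g i p).symm.trans ((DFunLike.congr_fun hg (i, p)).trans (hwt f i p))
      choose ρ hρ using hex
      have : g = fun j i => f (ρ i j) i := funext fun j => funext fun i => (hρ i j).symm
      rw [this, hY]
      simp
    · simp
  rw [MvPolynomial.coeff_sum, MvPolynomial.coeff_zero] at hcoeff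
  simp_rw [hterm] at hcoeff
  -- The coefficient is `Y f` times the number of words of the same weight, which is positive since
  -- `f` is one of them.
  rw [← sum_filter, sum_const, nsmul_eq_mul, mul_eq_zero, Nat.cast_eq_zero, card_eq_zero] at hcoeff
  refine hcoeff.resolve_left (Nonempty.ne_empty ⟨f, ?_⟩)
  simp

/-- Fixing the preimage of 0 leaves n! permutations in each row. -/
theorem sum_perm_apply_zero {R : Type*} [CommRing R] (Ψ : (Fin m → Fin (n + 1)) → R) :
    ∑ κ : Fin m → Equiv.Perm (Fin (n + 1)), Ψ (fun i => (κ i).symm 0) =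
      (n.factorial : R) ^ m * ∑ φ, Ψ φ := by
  let e : (Fin m → Equiv.Perm (Fin (n + 1))) ≃
      (Fin m → Fin (n + 1)) × (Fin m → Equiv.Perm (Fin n)) :=
    (Equiv.piCongrRight fun _ => (Equiv.inv _).trans Equiv.Perm.decomposeFin).trans
      (Equiv.arrowProdEquivProdArrow _ _ _)
  have h1 : ∑ κ : Fin m → Equiv.Perm (Fin (n + 1)), Ψ (fun i => (κ i).symm 0) =
      ∑ x : (Fin m → Fin (n + 1)) × (Fin m → Equiv.Perm (Fin n)), Ψ x.1 := by
    refine Fintype.sum_equiv e _ _ fun κ => congrArg Ψ (funext fun i => ?_)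
    have : ∀ σ : Equiv.Perm (Fin (n + 1)), σ 0 = (Equiv.Perm.decomposeFin σ).1 := fun σ => by
      conv_lhs => rw [← Equiv.Perm.decomposeFin.symm_apply_apply σ]
      exact Equiv.Perm.decomposeFin_symm_apply_zero _ _
    exact this (κ i).symm
  rw [h1, Fintype.sum_prod_type]
  simp only [sum_const, card_univ, ← mul_sum, nsmul_eq_mul]
  congr 1
  simp [Fintype.card_perm]

/-- In row `i` the argument `u i` lands in the factor `(κ i).symm 0`; all other places are filled
with entries of `X`. -/
theorem sum_polarDet_cons_mul {R : Type*} [CommRing R] (X : Matrix (Fin m) (Fin m) R)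
    (u : Fin m → Fin m) :
    ∑ f : Fin n → Fin m → Fin m,
      (polarDet (Fin.cons u f : Fin (n + 1) → Fin m → Fin m) : R) * ∏ j, ∏ i, X i (f j i) =
    ∑ κ : Fin m → Equiv.Perm (Fin (n + 1)),
      ∏ q, (replaceRows X (fun i => (κ i).symm 0) q u).det := by
  let Z : Fin (n + 1) → Fin m → Fin m → R :=
    Fin.cons (fun i p => if u i = p then 1 else 0) fun _ i p => X i p
  have hZ0 : ∀ i p, Z 0 i p = if u i = p then 1 else 0 := fun _ _ => rfl
  have hZs : ∀ (j : Fin n) i p, Z j.succ i p = X i p := fun _ _ _ => rfl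
  refine Eq.trans ?_ ((sum_polarDet_mul Z).trans
    (sum_congr rfl fun κ _ => prod_congr rfl fun q _ => congrArg Matrix.det ?_))
  · rw [← (Fin.consEquiv fun _ => Fin m → Fin m).sum_comp, Fintype.sum_prod_type]
    rw [sum_eq_single u]
    · refine sum_congr rfl fun f _ => ?_
      simp [Fin.prod_univ_succ, Fin.consEquiv, hZ0, hZs]
    · intro b _ hb
      obtain ⟨i, hi⟩ := Function.ne_iff.1 hb
      refine sum_eq_zero fun f _ => ?_
      rw [Fin.prod_univ_succ, prod_eq_zero (mem_univ i)]
      · simp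
      · simp [Fin.consEquiv, hZ0, hi.symm]
    · simp
  · ext i p
    simp only [replaceRows, Matrix.of_apply, Equiv.symm_apply_eq]
    by_cases hq : κ i q = 0
    · rw [if_pos hq.symm, hq, hZ0]
    · rw [if_neg (Ne.symm hq)]
      obtain ⟨j, hj⟩ := Fin.exists_succ_eq.2 hq
      rw [← hj, hZs]

theorem sum_polarDet_mul_prod {R : Type*} [CommRing R] (X : Matrix (Fin m) (Fin m) R) :
    ∑ f : Fin n → Fin m → Fin m, (polarDet f : R) * ∏ j, ∏ i, X i (f j i) =
      (n.factorial : R) ^ m * X.det ^ n := by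
  rw [sum_polarDet_mul fun _ i p => X i p]
  have : (Matrix.of fun i p => X i p).det = X.det := rfl
  simp [Fintype.card_perm, this]

/-- The polarized form of Cayley's identity. -/
theorem sum_polarDet_cons (f : Fin n → Fin m → Fin m) :
    ∑ u : Fin m → Fin m, wordDet u * polarDet (Fin.cons u f : Fin (n + 1) → Fin m → Fin m) =
      (n + 1).ascFactorial m * polarDet f := by
  let X := Matrix.mvPolynomialX (Fin m) (Fin m) ℤ
  refine sub_eq_zero.1 (eq_zero_of_symmetric (fun f => ∑ u : Fin m → Fin m,
    wordDet u * polarDet (Fin.cons u f : Fin (n + 1) → Fin m → Fin m) -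
      (n + 1).ascFactorial m * polarDet f) ?_ ?_ f)
  · intro f ρ
    simp only [polarDet_comp_perm]
    congr 1
    refine sum_congr rfl fun u _ => ?_
    -- The permutations of the n old arguments are extended so as to fix the new argument at 0.
    rw [← polarDet_comp_perm (Fin.cons u f) fun i => Equiv.Perm.decomposeFin.symm (0, ρ i)]
    congr 2
    funext j i
    refine Fin.cases ?_ (fun j => ?_) j
    · rw [Equiv.Perm.decomposeFin_symm_apply_zero, Fin.cons_zero, Fin.cons_zero]
    · rw [Equiv.Perm.decomposeFin_symm_apply_succ, Equiv.swap_self, Equiv.refl_apply,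
        Fin.cons_succ, Fin.cons_succ]
  · have h1 : ∀ u : Fin m → Fin m, ∑ f : Fin n → Fin m → Fin m,
        (polarDet (Fin.cons u f : Fin (n + 1) → Fin m → Fin m) :
          MvPolynomial (Fin m × Fin m) ℤ) * ∏ j, ∏ i, X i (f j i) =
        (n.factorial : MvPolynomial (Fin m × Fin m) ℤ) ^ m *
          ∑ φ : Fin m → Fin (n + 1), ∏ q, (replaceRows X φ q u).det := fun u => by
      rw [sum_polarDet_cons_mul, sum_perm_apply_zero fun φ => ∏ q, (replaceRows X φ q u).det]
    have h2 : ∑ u : Fin m → Fin m, (wordDet u : MvPolynomial (Fin m × Fin m) ℤ) *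
        ∑ f : Fin n → Fin m → Fin m,
          (polarDet (Fin.cons u f : Fin (n + 1) → Fin m → Fin m) :
            MvPolynomial (Fin m × Fin m) ℤ) * ∏ j, ∏ i, X i (f j i) =
        ((n + 1).ascFactorial m : MvPolynomial (Fin m × Fin m) ℤ) *
          ∑ f : Fin n → Fin m → Fin m, (polarDet f : MvPolynomial (Fin m × Fin m) ℤ) *
            ∏ j, ∏ i, X i (f j i) := by
      rw [sum_polarDet_mul_prod, mul_left_comm, ← cayley_identity m n, sum_comm, mul_sum]
      refine sum_congr rfl fun u _ => ?_
      rw [h1, ← mul_sum, mul_left_comm]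
    have h3 : ∀ f : Fin n → Fin m → Fin m,
        ((∑ u : Fin m → Fin m,
          wordDet u * polarDet (Fin.cons u f : Fin (n + 1) → Fin m → Fin m) -
            (n + 1).ascFactorial m * polarDet f : ℤ) : MvPolynomial (Fin m × Fin m) ℤ) =
        ∑ u : Fin m → Fin m, (wordDet u : MvPolynomial (Fin m × Fin m) ℤ) *
          (polarDet (Fin.cons u f : Fin (n + 1) → Fin m → Fin m) :
            MvPolynomial (Fin m × Fin m) ℤ) -
          ((n + 1).ascFactorial m : MvPolynomial (Fin m × Fin m) ℤ) *
            (polarDet f : MvPolynomial (Fin m × Fin m) ℤ) := fun f => by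
      push_cast
      rfl
    simp_rw [h3, sub_mul, sum_sub_distrib, sum_mul]
    rw [sub_eq_zero, sum_comm]
    simp_rw [mul_sum] at h2
    simp only [mul_assoc]
    exact h2

theorem sum_wordDet_polarDet (m : ℕ) : ∀ n : ℕ,
    ∑ f : Fin n → Fin m → Fin m, (∏ j, wordDet (f j)) * polarDet f = hookProduct m n := by
  intro n
  induction n with
  | zero => simp [polarDet, hookProduct]
  | succ n ih =>
    rw [← (Fin.consEquiv fun _ => Fin m → Fin m).sum_comp, Fintype.sum_prod_type_right, hookProduct,
      prod_range_succ, ← hookProduct, Nat.cast_mul, ← ih, sum_mul]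
    refine sum_congr rfl fun f _ => ?_
    have h := sum_polarDet_cons f
    rw [Nat.ascFactorial_eq_div, add_comm n m] at h
    rw [mul_assoc, mul_comm (polarDet f), ← h, mul_sum]
    refine sum_congr rfl fun u _ => ?_
    simp only [Fin.consEquiv, Fin.prod_univ_succ, Equiv.coe_fn_mk, Fin.cons_zero, Fin.cons_succ]
    ring

end Polarization

/-- The alternating sum at the unit vectors of the trivial tableau. -/
theorem alternatingSum_trivial (m n : ℕ) :
    alternatingSum m n (Tableau.trivial m n).rowOf (Tableau.trivial m n).colOf =
      hookProduct m n := by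
  rw [← sum_wordDet_polarDet]
  have h1 : alternatingSum m n (Tableau.trivial m n).rowOf (Tableau.trivial m n).colOf =
      ∑ σ : Equiv.Perm (Fin m × Fin n), ((Equiv.Perm.sign σ : ℤ) : ℤ) *
        ((∏ j, wordDet fun i => (σ (i, j)).1) * ∏ i, wordDet fun j => (σ (i, j)).2) := by
    refine Fintype.sum_equiv (Equiv.permCongr (Tableau.trivial m n).symm) _ _ fun σ => ?_
    rw [Equiv.Perm.sign_permCongr]
    rfl
  have h2 : ∀ F : (Fin m → Fin n → Fin n) → ℤ,
      ∑ g : Fin m → Fin n → Fin n, (∏ i, wordDet (g i)) * F g =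
      ∑ κ : Fin m → Equiv.Perm (Fin n), (∏ i, (Equiv.Perm.sign (κ i) : ℤ)) * F fun i => κ i := by
    intro F
    simp_rw [wordDet_eq_sum_perm, prod_univ_sum, Fintype.piFinset_univ, sum_mul]
    rw [sum_comm]
    refine sum_congr rfl fun κ _ => ?_
    simp_rw [prod_mul_distrib, prod_ite_zero]
    rw [sum_eq_single fun i => (κ i : Fin n → Fin n)]
    · simp
    · intro g _ hg
      have : ¬ ∀ i, g i = κ i := fun h => hg (funext h)
      simp [this]
    · simp
  have h3 := sum_wordDet_mul (ι := Fin m × Fin n) (R := ℤ) fun w =>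
    (∏ j, wordDet fun i => (w (i, j)).1) * ∏ i, wordDet fun j => (w (i, j)).2
  rw [h1, ← Int.cast_id (n := ∑ σ : Equiv.Perm (Fin m × Fin n), _)]
  simp only [Int.cast_id] at h3 ⊢
  -- The sum over permutations is widened to all self-maps of the cells, so that the two coordinates
  -- become independent words.
  rw [← h3]
  let e : (Fin m × Fin n → Fin m × Fin n) ≃ (Fin n → Fin m → Fin m) × (Fin m → Fin n → Fin n) :=
    { toFun := fun w => (fun j i => (w (i, j)).1, fun i j => (w (i, j)).2)
      invFun := fun y x => (y.1 x.2 x.1, y.2 x.1 x.2)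
      left_inv := fun w => rfl
      right_inv := fun y => rfl }
  rw [← e.symm.sum_comp, Fintype.sum_prod_type]
  simp_rw [polarDet, mul_sum]
  rw [sum_comm, sum_comm (t := (univ : Finset (Fin m → Equiv.Perm (Fin n))))]
  have h4 : ∀ g : Fin m → Fin n → Fin n, ∑ f : Fin n → Fin m → Fin m,
      wordDet (e.symm (f, g)) * ((∏ j, wordDet fun i => (e.symm (f, g) (i, j)).1) *
        ∏ i, wordDet fun j => (e.symm (f, g) (i, j)).2) =
      (∏ i, wordDet (g i)) * ∑ f : Fin n → Fin m → Fin m,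
        wordDet (e.symm (f, g)) * ∏ j, wordDet (f j) := by
    intro g
    rw [mul_sum]
    refine sum_congr rfl fun f _ => ?_
    simp only [e, Equiv.coe_fn_symm_mk]
    ring
  simp_rw [h4]
  rw [h2 fun g => ∑ f : Fin n → Fin m → Fin m, wordDet (e.symm (f, g)) * ∏ j, wordDet (f j)]
  refine sum_congr rfl fun κ _ => ?_
  rw [mul_sum]
  let e' : (Fin n → Fin m → Fin m) ≃ (Fin n → Fin m → Fin m) :=
    { toFun := fun f q i => f (κ i q) i
      invFun := fun f q i => f ((κ i).symm q) i
      left_inv := fun f => by simp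
      right_inv := fun f => by simp }
  rw [← e'.sum_comp]
  refine sum_congr rfl fun f _ => ?_
  let r : Equiv.Perm (Fin m × Fin n) := Equiv.prodCongrRight κ
  have hr : (Equiv.Perm.sign r : ℤ) = ∏ i, (Equiv.Perm.sign (κ i) : ℤ) := by
    rw [← wordDet_perm r]
    simp_rw [← wordDet_perm]
    exact (prod_wordDet_fst fun i => κ i).symm
  -- The substitution by `e'` makes the self-map factor through `r`, whose sign cancels the product
  -- of the signs of the `κ i`; the other row arrangement of `f` then sums to `polarDet`.
  have h5 : wordDet (e.symm (e' f, fun i => κ i)) =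
      (Equiv.Perm.sign r : ℤ) * ∏ j, wordDet (f j) := by
    rw [prod_wordDet_snd fun i j => f j i, ← wordDet_comp_perm]
    rfl
  have hsq : (Equiv.Perm.sign r : ℤ) * (Equiv.Perm.sign r : ℤ) = 1 := by
    rw [← Units.val_mul, Int.units_mul_self, Units.val_one]
  rw [h5, ← hr]
  calc _ = ((Equiv.Perm.sign r : ℤ) * (Equiv.Perm.sign r : ℤ)) *
        ((∏ j, wordDet (f j)) * ∏ j, wordDet (e' f j)) := by ring
    _ = _ := by rw [hsq, one_mul]; rfl

/-! ### Degenerate and homogeneous Vandermonde matrices as matrices of point rows -/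

section Completion

variable {M : ℕ} {P : Fin M → Prop} (g : {t // P t} → Fin M) (hg : Function.Injective g)

theorem completion_apply {t : Fin M} (ht : P t) : completion g hg t = g ⟨t, ht⟩ := by
  classical
  simp [completion, Equiv.subtypeCongr, Equiv.sumCompl_symm_apply_of_pos ht]

end Completion

section Points

variable {R : Type*} [CommRing R]

/-- The list of the values of all monomials at the point with label `s`; for a label `s` which does
not stand for a point, the unit vector at the monomial `p s`. -/
noncomputable def pointRow {d N ℓ L : ℕ} (z : Fin ℓ → Fin d → R) (p : Fin L → boxExpo d N) (s : Fin L)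
    (j : Fin ((N + 1) ^ d)) : R :=
  if h : s.1 < ℓ then (boxEnum d N j).1.eval (z ⟨s.1, h⟩)
  else if (boxEnum d N).symm (p s) = j then 1 else 0

theorem pointRow_of_lt {d N ℓ L : ℕ} (z : Fin ℓ → Fin d → R) (p : Fin L → boxExpo d N) {s : Fin L}
    (h : s.1 < ℓ) (j : Fin ((N + 1) ^ d)) :
    pointRow z p s j = (boxEnum d N j).1.eval (z ⟨s.1, h⟩) :=
  dif_pos h

theorem pointRow_of_le {d N ℓ L : ℕ} (z : Fin ℓ → Fin d → R) (p : Fin L → boxExpo d N) {s : Fin L}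
    (h : ℓ ≤ s.1) (j : Fin ((N + 1) ^ d)) :
    pointRow z p s j = if (boxEnum d N).symm (p s) = j then 1 else 0 :=
  dif_neg (not_lt.2 h)

theorem sign_mul_det_submatrix {ι : Type*} [Fintype ι] [DecidableEq ι] (σ : Equiv.Perm ι)
    (M : Matrix ι ι R) :
    ((Equiv.Perm.sign σ : ℤ) : R) * (M.submatrix id σ).det = M.det := by
  rw [Matrix.det_permute', ← mul_assoc, ← Int.cast_mul, ← Units.val_mul, Int.units_mul_self,
    Units.val_one, Int.cast_one, one_mul]

/-- After the columns are permuted by the completion, the unit rows form an identity block, and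
removing it deletes their monomials. Two equal deleted monomials give two equal rows. -/
theorem degenerateFactor_eq_det {d N ℓ L : ℕ} (z : Fin ℓ → Fin d → R) (p : Fin L → boxExpo d N)
    (c : Fin ((N + 1) ^ d) → Fin L) :
    degenerateFactor z p c = (Matrix.of fun t j => pointRow z p (c t) j).det := by
  classical
  unfold degenerateFactor
  dsimp only
  set g : {t // ℓ ≤ (c t).1} → Fin ((N + 1) ^ d) := fun t => (boxEnum d N).symm (p (c t.1)) with hgdef
  split_ifs with hg
  · set π := completion g hg with hπ
    rw [← sign_mul_det_submatrix π]
    congr 1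
    rw [Matrix.twoBlockTriangular_det _ fun t => ¬ ℓ ≤ (c t).1]
    · have h2 : Matrix.toSquareBlockProp ((Matrix.of fun t j => pointRow z p (c t) j).submatrix id π)
          (fun t => ¬ ¬ ℓ ≤ (c t).1) = 1 := by
        ext i j
        have hi := not_not.1 i.2
        simp only [Matrix.toSquareBlockProp, Matrix.toBlock_apply, Matrix.submatrix_apply, id,
          Matrix.of_apply, pointRow_of_le z p hi, Matrix.one_apply, Subtype.ext_iff]
        have h3 : (boxEnum d N).symm (p (c i.1)) = π i.1 := (completion_apply g hg hi).symm
        rw [h3]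
        simp
      rw [h2, Matrix.det_one, mul_one]
      unfold degenerateDet
      congr 1
      ext i j
      exact (pointRow_of_lt z p (not_le.1 i.2) _).symm
    · intro i hi j hj
      have hi := not_not.1 hi
      simp only [Matrix.of_apply, Matrix.submatrix_apply, id, pointRow_of_le z p hi]
      have h3 : (boxEnum d N).symm (p (c i)) = π i := (completion_apply g hg hi).symm
      rw [h3, if_neg]
      intro h
      rw [π.injective h] at hi
      exact hj hi
  · simp only [Function.Injective, not_forall] at hg
    obtain ⟨t, t', h, hne⟩ := hg
    refine (Matrix.det_zero_of_row_eq (fun h' => hne (Subtype.ext h') : t.1 ≠ t'.1) ?_).symm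
    funext j
    simp only [Matrix.of_apply, pointRow_of_le z p t.2, pointRow_of_le z p t'.2]
    rw [show (boxEnum d N).symm (p (c t.1)) = (boxEnum d N).symm (p (c t'.1)) from h]

theorem homCount_le (k l N : ℕ) : homCount (k + l) N ≤ (N + 1) ^ l * (N + 1) ^ k := by
  rw [← pow_add, add_comm l k, ← card_boxExpo]
  exact card_le_card (filter_subset _ _)

variable {k l N : ℕ} (w : Fin ((N + 1) ^ l * (N + 1) ^ k) ≃ boxExpo (k + l) N)
  (z : Fin (homCount (k + l) N) → Fin (k + l) → R)

theorem eval_leftExpo_mul_eval_rightExpo (e : boxExpo (k + l) N) (x : Fin (k + l) → R) :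
    ((leftExpo e).1.eval fun i => x (Fin.castAdd l i)) *
      ((rightExpo e).1.eval fun i => x (Fin.natAdd k i)) = e.1.eval x := by
  simp only [Expo.eval, Fin.prod_univ_add]
  rfl

/-- The homogeneous Vandermonde determinant is the determinant of tensor products of point rows. -/
theorem det_homVandermonde_eq
    (hw : ∀ (s : Fin ((N + 1) ^ l * (N + 1) ^ k)) (hs : s.1 < homCount (k + l) N),
      (w s).1 = (homEnum (k + l) N ⟨s.1, hs⟩).1) :
    (homVandermonde (k + l) N z).det = ((enumerationSign w : ℤ) : R) *
      (Matrix.of fun s t =>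
        pointRow (fun s i => z s (Fin.castAdd l i)) (fun s => leftExpo (w s)) s
          ((Tableau.trivial _ _).symm t).1 *
        pointRow (fun s j => z s (Fin.natAdd k j)) (fun s => rightExpo (w s)) s
          ((Tableau.trivial _ _).symm t).2).det := by
  set A : Matrix (Fin ((N + 1) ^ l * (N + 1) ^ k)) (Fin ((N + 1) ^ l * (N + 1) ^ k)) R :=
    Matrix.of fun s t =>
        pointRow (fun s i => z s (Fin.castAdd l i)) (fun s => leftExpo (w s)) s
          ((Tableau.trivial _ _).symm t).1 *
        pointRow (fun s j => z s (Fin.natAdd k j)) (fun s => rightExpo (w s)) s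
          ((Tableau.trivial _ _).symm t).2 with hA
  let ω : Equiv.Perm (Fin ((N + 1) ^ l * (N + 1) ^ k)) :=
    Equiv.ofBijective (fun s => kroneckerIndex (w s))
      (Finite.injective_iff_bijective.1 (kroneckerIndex_injective.comp w.injective))
  have hω : ∀ s, (Tableau.trivial _ _).symm (ω s) =
      ((boxEnum k N).symm (leftExpo (w s)), (boxEnum l N).symm (rightExpo (w s))) := fun s =>
    (Tableau.trivial _ _).symm_apply_apply _
  have hlt : ∀ s t (hs : s.1 < homCount (k + l) N), A s (ω t) = (w t).1.eval (z ⟨s.1, hs⟩) := by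
    intro s t hs
    rw [← eval_leftExpo_mul_eval_rightExpo]
    simp only [hA, Matrix.of_apply, hω, pointRow_of_lt _ _ hs, OrderIso.apply_symm_apply]
  -- The rows without a point become rows of the identity matrix, so only the block of points and
  -- monomials of total degree at most `N` contributes.
  have hle : ∀ s t, homCount (k + l) N ≤ s.1 → A s (ω t) = if s = t then 1 else 0 := by
    intro s t hs
    have hiff : s = t ↔ (boxEnum k N).symm (leftExpo (w s)) = (boxEnum k N).symm (leftExpo (w t)) ∧
        (boxEnum l N).symm (rightExpo (w s)) = (boxEnum l N).symm (rightExpo (w t)) := by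
      rw [← Prod.mk.injEq, ← hω, ← hω, (Tableau.trivial _ _).symm.injective.eq_iff,
        ω.injective.eq_iff]
    simp only [hA, Matrix.of_apply, hω, pointRow_of_le _ _ hs]
    rw [ite_zero_mul_ite_zero, mul_one, if_congr hiff rfl rfl]
  rw [← sign_mul_det_submatrix ω A, ← mul_assoc,
    show enumerationSign w = Equiv.Perm.sign ω from rfl, ← Int.cast_mul, ← Units.val_mul,
    Int.units_mul_self, Units.val_one, Int.cast_one, one_mul,
    Matrix.twoBlockTriangular_det (A.submatrix id ω) fun s => s.1 < homCount (k + l) N]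
  · have h2 : (A.submatrix id ω).toSquareBlockProp (fun s => ¬ s.1 < homCount (k + l) N) = 1 := by
      ext i j
      simp only [Matrix.toSquareBlockProp, Matrix.toBlock_apply, Matrix.submatrix_apply, id,
        hle _ _ (not_lt.1 i.2), Matrix.one_apply, Subtype.ext_iff]
    rw [h2, Matrix.det_one, mul_one]
    let e : {s : Fin ((N + 1) ^ l * (N + 1) ^ k) // s.1 < homCount (k + l) N} ≃
        Fin (homCount (k + l) N) :=
      { toFun := fun s => ⟨s.1.1, s.2⟩
        invFun := fun i => ⟨⟨i.1, i.2.trans_le (homCount_le k l N)⟩, i.2⟩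
        left_inv := fun _ => rfl
        right_inv := fun _ => rfl }
    rw [← Matrix.det_submatrix_equiv_self e]
    congr 1
    ext i j
    simp only [Matrix.toSquareBlockProp, Matrix.toBlock_apply, Matrix.submatrix_apply, id,
      hlt _ _ i.2, homVandermonde, hw _ j.2]
    rfl
  · intro i hi j hj
    rw [Matrix.submatrix_apply, id, hle _ _ (not_lt.1 hi), if_neg]
    rintro rfl
    exact hi hj

end Points

end HomVandermonde

open HomVandermonde in
theorem mainTheorem6 {R : Type*} [CommRing R] (k l N : ℕ) (hk : 1 ≤ k) (hl : 1 ≤ l) (hN : 1 ≤ N)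
    (w : Fin ((N + 1) ^ l * (N + 1) ^ k) ≃ boxExpo (k + l) N)
    (hw : ∀ (s : Fin ((N + 1) ^ l * (N + 1) ^ k)) (hs : s.1 < homCount (k + l) N),
      (w s).1 = (homEnum (k + l) N ⟨s.1, hs⟩).1)
    (z : Fin (homCount (k + l) N) → Fin (k + l) → R) :
    IsUnit (signedFayersMatrix ((N + 1) ^ k) ((N + 1) ^ l)).det ∧
    (homVandermonde (k + l) N z).det =
      ((enumerationSign w : ℤ) : R) *
        ∑ α : StdTableau ((N + 1) ^ k) ((N + 1) ^ l), ∑ β : StdTableau ((N + 1) ^ k) ((N + 1) ^ l),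
          ((fayersPhi ((N + 1) ^ k) ((N + 1) ^ l) α β : ℤ) : R) *
            (colProduct z w α.1 * rowProduct z w β.1) ∧
    (hookProduct ((N + 1) ^ k) ((N + 1) ^ l) : R) * (homVandermonde (k + l) N z).det =
      ((enumerationSign w : ℤ) : R) *
        ∑ σ : Equiv.Perm (Fin ((N + 1) ^ l * (N + 1) ^ k)),
          ((Equiv.Perm.sign σ : ℤ) : R) *
            (colProduct z w ((Tableau.trivial ((N + 1) ^ k) ((N + 1) ^ l)).trans σ) *
              rowProduct z w ((Tableau.trivial ((N + 1) ^ k) ((N + 1) ^ l)).trans σ)) := by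
  refine ⟨isUnit_det_signedFayersMatrix _ _, ?_, ?_⟩
  · rw [det_homVandermonde_eq w z hw, tensor_det_eq_sum_fayersPhi]
    simp only [colProduct, rowProduct, degenerateFactor_eq_det]
  · have h := alternatingSum_mul_tensor_det
      (pointRow (fun s i => z s (Fin.castAdd l i)) fun s => leftExpo (w s))
      (pointRow (fun s j => z s (Fin.natAdd k j)) fun s => rightExpo (w s))
    rw [alternatingSum_trivial, Int.cast_natCast] at h
    rw [det_homVandermonde_eq w z hw, mul_left_comm, h]
    simp only [colProduct, rowProduct, degenerateFactor_eq_det]
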